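/- **Setting.** Let $d,k\ge 1$ be integers and $p\ge 1$ real. Let $\|\cdot\|$ be a norm on $\mathbb R^d$ that is invariant under changing the sign of a coordinate and gives each canonical basis vector length $1$; put $\kappa(x,y)=\|x-y\|$ and let $\mathcal B_d=\{x:\|x\|\le \tfrac12\}$ be the $\kappa$-ball of diameter $1$ about the origin. For $F\subset\mathcal B_d$ with $|F|=k$ put $\kappa(x,F)=\min_{f\in F}\kappa(x,f)$. For a probability distribution $\mathbb P$ on $\mathcal B_d$ let $$\mathrm{OPT}=\inf_{F\subset\mathcal B_d,\ |F|=k}\ \mathbb E_{x\sim\mathbb P}\,\kappa(x,F)^p ,$$ and for points $x_1,\dots,x_n\in\mathcal B_d$, $n\ge1$, let $$\widehat{\mathrm{OPT}}(x_1,\dots,x_n)=\inf_{F\subset\mathcal B_d,\ |F|=k}\ \frac1n\sum_{i=1}^n\kappa(x_i,F)^p .$$ Let $\beta\ge1$. A *$\beta$-approximate value oracle* is a (measurable) map $\mathcal A$ that assigns to every finite instance $x_1,\dots,x_n$ ($n\ge1$) a number in $\bigl[\tfrac1\beta\widehat{\mathrm{OPT}},\widehat{\mathrm{OPT}}\bigr]$.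 An *algorithm* has a random string $r$ of independent fair bits. Adaptively, depending on $r$ and on the oracle answers so far, it either draws a number of fresh i.i.d. samples from $\mathbb P$ and queries $\mathcal A$ on this batch, or halts and outputs a real number. It uses the samples only through these oracle calls and knows neither $\mathbb P$, $\mathrm{OPT}$ nor $\mathcal A$. With a given oracle it is *$\rho$-replicable* if for every distribution $\mathbb P$ on $\mathcal B_d$, two executions on independent sequences of i.i.d. samples from $\mathbb P$ with the same string $r$ have the same result (equal outputs, or neither halts) with probability at least $1-\rho$. **Theorem (OPT estimation with relative error).** There are universal constants $C>0$ and $c\in\mathbb N$ such that the following holds for all $d,k,p,\|\cdot\|,\beta$ as above and all $\varepsilon,\rho\in(0,1)$, $\delta\in(0,\rho/3)$. There is an algorithm such that for every $\beta$-approximate value oracle $\mathcal A$ the algorithm is $\rho$-replicable, and for every distribution $\mathbb P$ on $\mathcal B_d$ with $\mathrm{OPT}>0$ it halts almost surely and, with probability at least $1-\delta$, it outputs an estimate $$\Lambda\in\left[\frac{1}{\beta(1+\varepsilon)}\,\mathrm{OPT},\ (1+\varepsilon)\,\mathrm{OPT}\right]$$ after drawing at most $C\,f\,\log^{c}(2+f)$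 samples in total, where $$f=\frac{k^2d^2\beta^{12}}{\varepsilon^{12}\rho^{6}\,\mathrm{OPT}^{12}}\,\log\frac p\delta ,$$ that is, $\tilde O\!\left(\frac{k^2d^2\beta^{12}}{\varepsilon^{12}\rho^6\,\mathrm{OPT}^{12}}\log\frac p\delta\right)$ samples. -/

import Mathlib

open MeasureTheory

namespace ReplicableClustering

/-! ### Statistical and sample `(k, p)`-clustering -/

/-- A norm on `ℝ^d` that is invariant under changing the sign of a coordinate and gives every
vector of the canonical basis length one. The metric is `κ(x, y) = N (x - y)`. -/
structure IsClusteringNorm {d : ℕ} (N : Seminorm ℝ (Fin d → ℝ)) : Prop where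
  definite : ∀ x, N x = 0 → x = 0
  sign_invariant : ∀ x i, N (Function.update x i (-x i)) = N x
  normalized : ∀ i, N (Pi.single i 1) = 1

/-- The closed ball of diameter one (radius one half) centred at the origin. -/
def diamBall {d : ℕ} (N : Seminorm ℝ (Fin d → ℝ)) : Set (Fin d → ℝ) :=
  {x | N x ≤ 1 / 2}

/-- Admissible sets of centers: `k`-element subsets of the ball. -/
def centerSets {d : ℕ} (N : Seminorm ℝ (Fin d → ℝ)) (k : ℕ) : Set (Finset (Fin d → ℝ)) :=
  {F | (∀ f ∈ F, f ∈ diamBall N) ∧ F.card = k}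

/-- The distance `κ(x, F)` from `x` to a closest point of the (finite, non-empty) set `F`. -/
noncomputable def distTo {d : ℕ} (N : Seminorm ℝ (Fin d → ℝ)) (x : Fin d → ℝ)
    (F : Finset (Fin d → ℝ)) : ℝ :=
  sInf ((fun f => N (x - f)) '' (F : Set (Fin d → ℝ)))

/-- The statistical cost `E_{x ∼ P} κ(x, F)^p`. -/
noncomputable def cost {d : ℕ} (N : Seminorm ℝ (Fin d → ℝ)) (p : ℝ) (P : Measure (diamBall N))
    (F : Finset (Fin d → ℝ)) : ℝ :=
  ∫ x, distTo N (x : Fin d → ℝ) F ^ p ∂P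

/-- The optimal statistical cost. -/
noncomputable def OPT {d : ℕ} (N : Seminorm ℝ (Fin d → ℝ)) (k : ℕ) (p : ℝ)
    (P : Measure (diamBall N)) : ℝ :=
  sInf (cost N p P '' centerSets N k)

/-- The sample cost `(1/n) ∑ i, κ(x_i, F)^p`. -/
noncomputable def sampleCost {d : ℕ} (N : Seminorm ℝ (Fin d → ℝ)) (p : ℝ) {n : ℕ}
    (x : Fin n → diamBall N) (F : Finset (Fin d → ℝ)) : ℝ :=
  (1 / (n : ℝ)) * ∑ i, distTo N (x i : Fin d → ℝ) F ^ p

/-- The optimal cost of an instance of sample `(k, p)`-clustering. -/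
noncomputable def sampleOPT {d : ℕ} (N : Seminorm ℝ (Fin d → ℝ)) (k : ℕ) (p : ℝ) {n : ℕ}
    (x : Fin n → diamBall N) : ℝ :=
  sInf (sampleCost N p x '' centerSets N k)

/-- `A` is a `β`-approximate estimator of the optimal value of sample `(k, p)`-clustering:
on every instance with at least one point its value lies in `[sampleOPT / β, sampleOPT]`. -/
structure IsValueOracle {d : ℕ} (N : Seminorm ℝ (Fin d → ℝ)) (k : ℕ) (p β : ℝ)
    (A : (n : ℕ) → (Fin n → diamBall N) → ℝ) : Prop where
  measurable : ∀ n, Measurable (A n)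
  approx : ∀ n, 1 ≤ n → ∀ x : Fin n → diamBall N,
    A n x ∈ Set.Icc (1 / β * sampleOPT N k p x) (sampleOPT N k p x)

/-! ### Randomized algorithms with black-box access to an oracle on fresh samples -/

/-- A randomized algorithm that adaptively queries an oracle on batches of fresh samples.
Given the random binary string and the answers to its first `t` queries, `next t` is either
`Sum.inl n` (draw `n` fresh samples and query the oracle on them) or `Sum.inr Λ` (halt with
output `Λ`). The algorithm itself looks at the samples only through the oracle. -/
structure OracleAlgorithm where
  next : (t : ℕ) → (ℕ → Bool) × (Fin t → ℝ) → ℕ ⊕ ℝ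
  measurable_next : ∀ t, Measurable (next t)

/-- `alg.Reaches A x r t ξ m`: on the stream of samples `x` and the random string `r`, the
algorithm makes a `t`-th query, the answers to its first `t` queries are `ξ`, and these queries
have used the first `m` samples of the stream. -/
inductive OracleAlgorithm.Reaches {X : Type} (alg : OracleAlgorithm)
    (A : (n : ℕ) → (Fin n → X) → ℝ) (x : ℕ → X) (r : ℕ → Bool) :
    (t : ℕ) → (Fin t → ℝ) → ℕ → Prop where
  | start : Reaches alg A x r 0 Fin.elim0 0
  | query (t : ℕ) (ξ : Fin t → ℝ) (m n : ℕ) (h : Reaches alg A x r t ξ m)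
      (hn : alg.next t (r, ξ) = Sum.inl n) :
      Reaches alg A x r (t + 1) (Fin.snoc (α := fun _ => ℝ) ξ (A n fun i => x (m + i))) (m + n)

/-- On the stream of samples `x` and the random string `r`, the algorithm halts with output `Λ`
after having drawn `m` samples. -/
def OracleAlgorithm.Outputs {X : Type} (alg : OracleAlgorithm)
    (A : (n : ℕ) → (Fin n → X) → ℝ) (x : ℕ → X) (r : ℕ → Bool) (Λ : ℝ) (m : ℕ) : Prop :=
  ∃ (t : ℕ) (ξ : Fin t → ℝ), alg.Reaches A x r t ξ m ∧ alg.next t (r, ξ) = Sum.inr Λ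

/-- The law of an i.i.d. sequence of samples from `P`. -/
noncomputable def iidStream {X : Type} [MeasurableSpace X] (P : Measure X)
    [IsProbabilityMeasure P] : Measure (ℕ → X) :=
  Measure.infinitePi fun _ : ℕ => P

/-- The law of an infinite string of independent fair bits. -/
noncomputable def coins : Measure (ℕ → Bool) :=
  Measure.infinitePi fun _ : ℕ => (PMF.uniformOfFintype Bool).toMeasure

/-- For every distribution `P`, two executions on independent i.i.d. samples from `P` that share
the random string have the same result (the same output, or no output in either)
except with probability at most `ρ`. -/
def OracleAlgorithm.IsReplicable {X : Type} [MeasurableSpace X] (alg : OracleAlgorithm)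
    (A : (n : ℕ) → (Fin n → X) → ℝ) (ρ : ℝ) : Prop :=
  ∀ (P : Measure X) [IsProbabilityMeasure P],
    (((iidStream P).prod (iidStream P)).prod coins)
      {w | ¬ ∀ Λ : ℝ, (∃ m, alg.Outputs A w.1.1 w.2 Λ m) ↔ (∃ m, alg.Outputs A w.1.2 w.2 Λ m)}
      ≤ ENNReal.ofReal ρ

/-- A bound of the form `Õ(f)` with explicit constants: `C * f * log(2 + f)^c`. -/
noncomputable def softO (C : ℝ) (c : ℕ) (f : ℝ) : ℝ :=
  C * f * Real.log (2 + f) ^ c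

end ReplicableClustering

namespace ReplicableClustering

/-! ### The geometry of clustering norms -/

section Geometry

variable {d : ℕ} {N : Seminorm ℝ (Fin d → ℝ)}

/-! Stage `i` works at accuracy `α = 4^(-i)`. It averages the oracle's answers on many independent
batches and rounds the average down to a grid of width `α` with a random offset taken from the
shared string. It stops once the rounded value is at least `(4β/ε + 1)α`.

Replicability does not need the oracle to be stable: its answers may jump anywhere within the factor
`β`. But answers on independent batches are i.i.d. in `[0, 1]`, so their average concentrates around
its own expectation (`measure_blockMean_le`). Two numbers near a common value are rounded alike for
most offsets (`coins_randomRound_ne_le`). Failure probabilities `ρ / 2^(i+1)` sum to `ρ` over all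
stages, so with probability at least `1 - ρ` every stage agrees, and hence so do the stopping time
and the output, for every `P`.

Accuracy comes from uniform convergence: a finite net of center sets and Hoeffding's inequality put
the sample optimum of every batch within `α` of `OPT` (`measure_sampleOPT_deviation_le`), with total
failure probability `δ`. The estimate then lies in `[OPT/β - 2α, OPT + α]`. Passing the threshold
forces `4βα ≤ ε OPT`, which turns additive error into relative error (`mem_Icc_of_threshold_le`).
The threshold is passed once `7β²α ≤ ε OPT`, so `4^i ≤ 28β²/(ε OPT)` at the last stage. Stage `i`
uses about `d²k (4^i)^6 log(p/δ) / ρ³` samples, a geometric growth dominated by the last stage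
(`sample_bound`). -/

lemma IsClusteringNorm.abs_apply_le (hN : IsClusteringNorm N) (x : Fin d → ℝ) (i : Fin d) :
    |x i| ≤ N x := by
  -- The difference of `x` and its reflection has norm `2 |x i|`, while the triangle inequality and
  -- sign invariance bound it by `2 N x`.
  have h1 : x - Function.update x i (-x i) = (2 * x i) • Pi.single i (1 : ℝ) := by
    ext j
    by_cases h : j = i
    · subst h; simp; ring
    · simp [h]
  have h2 := map_sub_le_add N x (Function.update x i (-x i))
  rw [h1, map_smul_eq_mul, hN.normalized, hN.sign_invariant, Real.norm_eq_abs, abs_mul] at h2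
  norm_num at h2
  linarith

lemma IsClusteringNorm.le_sum_abs (hN : IsClusteringNorm N) (x : Fin d → ℝ) :
    N x ≤ ∑ i, |x i| := by
  have h : x = ∑ i, x i • Pi.single i (1 : ℝ) := by
    ext j
    simp [Finset.sum_apply, Pi.single_apply]
  calc N x = N (∑ i, x i • Pi.single i (1 : ℝ)) := by rw [← h]
    _ ≤ ∑ i, N (x i • Pi.single i (1 : ℝ)) :=
        Finset.le_sum_of_subadditive N (map_zero N).le (map_add_le_add N) _ _
    _ = ∑ i, |x i| := by simp [map_smul_eq_mul, hN.normalized]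

lemma exists_distTo_eq {F : Finset (Fin d → ℝ)} (hF : F.Nonempty) (x : Fin d → ℝ) :
    ∃ f ∈ F, distTo N x F = N (x - f) := by
  have h : sInf ((fun f => N (x - f)) '' (F : Set (Fin d → ℝ))) ∈
      (fun f => N (x - f)) '' (F : Set (Fin d → ℝ)) :=
    Set.Nonempty.csInf_mem (by simpa using hF) (F.finite_toSet.image _)
  obtain ⟨f, hf, e⟩ := h
  exact ⟨f, hf, e.symm⟩

lemma distTo_le {F : Finset (Fin d → ℝ)} {f : Fin d → ℝ} (hf : f ∈ F) (x : Fin d → ℝ) :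
    distTo N x F ≤ N (x - f) :=
  csInf_le ⟨0, by rintro _ ⟨g, -, rfl⟩; exact apply_nonneg N _⟩ ⟨f, hf, rfl⟩

lemma distTo_nonneg (x : Fin d → ℝ) (F : Finset (Fin d → ℝ)) : 0 ≤ distTo N x F :=
  Real.sInf_nonneg (by rintro _ ⟨g, -, rfl⟩; exact apply_nonneg N _)

lemma distTo_le_add {F : Finset (Fin d → ℝ)} (hF : F.Nonempty) (x y : Fin d → ℝ) :
    distTo N x F ≤ distTo N y F + N (x - y) := by
  obtain ⟨f, hf, e⟩ := exists_distTo_eq (N := N) hF y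
  rw [e, add_comm]
  calc distTo N x F ≤ N (x - f) := distTo_le hf x
    _ = N ((x - y) + (y - f)) := by congr 1; abel
    _ ≤ _ := map_add_le_add _ _ _

lemma continuous_distTo (hN : IsClusteringNorm N) {F : Finset (Fin d → ℝ)} (hF : F.Nonempty) :
    Continuous fun x => distTo N x F := by
  refine LipschitzWith.continuous (K := (d : NNReal)) (LipschitzWith.of_le_add_mul _ fun x y => ?_)
  refine (distTo_le_add hF x y).trans ?_
  gcongr
  calc N (x - y) ≤ ∑ i, |(x - y) i| := hN.le_sum_abs _
    _ ≤ ∑ _i : Fin d, dist x y := by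
        refine Finset.sum_le_sum fun i _ => ?_
        simpa [Real.dist_eq] using dist_le_pi_dist x y i
    _ = _ := by simp

lemma distTo_le_one {F : Finset (Fin d → ℝ)} (hF : F.Nonempty) (hFb : ∀ f ∈ F, f ∈ diamBall N)
    {x : Fin d → ℝ} (hx : x ∈ diamBall N) : distTo N x F ≤ 1 := by
  obtain ⟨f, hf⟩ := hF
  have h1 : N x ≤ 1 / 2 := hx
  have h2 : N f ≤ 1 / 2 := hFb f hf
  linarith [distTo_le (N := N) hf x, map_sub_le_add N x f]

lemma rpow_sub_rpow_le {p u v : ℝ} (hp : 1 ≤ p) (hv : 0 ≤ v) (huv : v ≤ u) (hu : u ≤ 1) :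
    u ^ p - v ^ p ≤ p * (u - v) := by
  rcases (hv.trans huv).eq_or_lt with h0 | h0
  · have : v = u := by linarith
    simp [this]
  -- Bernoulli's inequality for `(v/u)^p`; multiplying by `u^p ≤ u` then gives the Lipschitz bound.
  have h1 := one_add_mul_self_le_rpow_one_add (s := v / u - 1)
    (by linarith [div_nonneg hv h0.le]) hp
  have h2 : (1 + (v / u - 1)) ^ p = v ^ p / u ^ p := by
    rw [← Real.div_rpow hv h0.le]; congr 1; ring
  have h3 : 0 < u ^ p := Real.rpow_pos_of_pos h0 p
  rw [h2, le_div_iff₀ h3] at h1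
  have h4 : u ^ p ≤ u := by
    simpa using Real.rpow_le_rpow_of_exponent_ge h0 hu hp
  have h5 : u ^ p * (p * (1 - v / u)) ≤ u * (p * (1 - v / u)) := by
    refine mul_le_mul_of_nonneg_right h4 (mul_nonneg (by linarith) ?_)
    rw [sub_nonneg, div_le_one h0]; exact huv
  have h6 : u * (p * (1 - v / u)) = p * (u - v) := by field_simp
  nlinarith

lemma abs_rpow_sub_rpow_le {p u v : ℝ} (hp : 1 ≤ p) (hu : u ∈ Set.Icc (0 : ℝ) 1)
    (hv : v ∈ Set.Icc (0 : ℝ) 1) : |u ^ p - v ^ p| ≤ p * |u - v| := by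
  rcases le_total v u with h | h
  · rw [abs_of_nonneg (sub_nonneg.2 h), abs_of_nonneg]
    · exact rpow_sub_rpow_le hp hv.1 h hu.2
    · exact sub_nonneg.2 (Real.rpow_le_rpow hv.1 h (by linarith))
  · rw [abs_sub_comm, abs_sub_comm u, abs_of_nonneg (sub_nonneg.2 h), abs_of_nonneg]
    · exact rpow_sub_rpow_le hp hu.1 h hv.2
    · exact sub_nonneg.2 (Real.rpow_le_rpow hu.1 h (by linarith))

end Geometry

/-! ### Costs -/

section Cost

variable {d k : ℕ} {N : Seminorm ℝ (Fin d → ℝ)} {p : ℝ} {F : Finset (Fin d → ℝ)}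

lemma nonempty_of_mem_centerSets (hk : 1 ≤ k) (hF : F ∈ centerSets N k) : F.Nonempty :=
  Finset.card_pos.1 (by rw [hF.2]; omega)

lemma distTo_mem_Icc (hk : 1 ≤ k) (hF : F ∈ centerSets N k) (x : diamBall N) :
    distTo N (x : Fin d → ℝ) F ∈ Set.Icc (0 : ℝ) 1 :=
  ⟨distTo_nonneg _ _, distTo_le_one (nonempty_of_mem_centerSets hk hF) hF.1 x.2⟩

lemma distTo_rpow_mem_Icc (hk : 1 ≤ k) (hp : 1 ≤ p) (hF : F ∈ centerSets N k) (x : diamBall N) :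
    distTo N (x : Fin d → ℝ) F ^ p ∈ Set.Icc (0 : ℝ) 1 := by
  have h := distTo_mem_Icc hk hF x
  exact ⟨Real.rpow_nonneg h.1 _, Real.rpow_le_one h.1 h.2 (by linarith)⟩

lemma measurable_distTo_rpow (hN : IsClusteringNorm N) (hp : 1 ≤ p) (hF : F.Nonempty) :
    Measurable fun x : diamBall N => distTo N (x : Fin d → ℝ) F ^ p := by
  refine Continuous.measurable ?_
  exact ((continuous_distTo hN hF).comp continuous_subtype_val).rpow_const
    fun x => Or.inr (by linarith)

lemma integrable_distTo_rpow (hN : IsClusteringNorm N) (hk : 1 ≤ k) (hp : 1 ≤ p)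
    (hF : F ∈ centerSets N k) (P : Measure (diamBall N)) [IsProbabilityMeasure P] :
    Integrable (fun x : diamBall N => distTo N (x : Fin d → ℝ) F ^ p) P := by
  refine Integrable.of_mem_Icc 0 1
    (measurable_distTo_rpow hN hp (nonempty_of_mem_centerSets hk hF)).aemeasurable ?_
  exact Filter.Eventually.of_forall fun x => distTo_rpow_mem_Icc hk hp hF x

lemma cost_nonneg (P : Measure (diamBall N)) (F : Finset (Fin d → ℝ)) : 0 ≤ cost N p P F :=
  integral_nonneg fun _ => Real.rpow_nonneg (distTo_nonneg _ _) _

lemma cost_le_one (hN : IsClusteringNorm N) (hk : 1 ≤ k) (hp : 1 ≤ p)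
    (hF : F ∈ centerSets N k) (P : Measure (diamBall N)) [IsProbabilityMeasure P] :
    cost N p P F ≤ 1 := by
  refine (integral_mono (integrable_distTo_rpow hN hk hp hF P) (integrable_const 1)
    fun x => (distTo_rpow_mem_Icc hk hp hF x).2).trans ?_
  simp

lemma bddBelow_cost (P : Measure (diamBall N)) : BddBelow (cost N p P '' centerSets N k) :=
  ⟨0, by rintro _ ⟨F, -, rfl⟩; exact cost_nonneg P F⟩

lemma OPT_le_one (hN : IsClusteringNorm N) (hk : 1 ≤ k) (hp : 1 ≤ p)
    (P : Measure (diamBall N)) [IsProbabilityMeasure P] : OPT N k p P ≤ 1 := by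
  rcases (centerSets N k).eq_empty_or_nonempty with h | ⟨F, hF⟩
  · simp [OPT, h]
  · exact (csInf_le (bddBelow_cost P) ⟨F, hF, rfl⟩).trans (cost_le_one hN hk hp hF P)

lemma sampleCost_nonneg {n : ℕ} (x : Fin n → diamBall N) (F : Finset (Fin d → ℝ)) :
    0 ≤ sampleCost N p x F :=
  mul_nonneg (by positivity)
    (Finset.sum_nonneg fun _ _ => Real.rpow_nonneg (distTo_nonneg _ _) _)

lemma sampleCost_le_one (hk : 1 ≤ k) (hp : 1 ≤ p) (hF : F ∈ centerSets N k) {n : ℕ}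
    (x : Fin n → diamBall N) : sampleCost N p x F ≤ 1 := by
  have h : ∑ i, distTo N (x i : Fin d → ℝ) F ^ p ≤ ∑ _i : Fin n, (1 : ℝ) :=
    Finset.sum_le_sum fun i _ => (distTo_rpow_mem_Icc hk hp hF (x i)).2
  simp only [Finset.sum_const, Finset.card_univ, Fintype.card_fin, nsmul_eq_mul, mul_one] at h
  rcases n.eq_zero_or_pos with rfl | hn
  · simp [sampleCost]
  · rw [sampleCost, one_div, inv_mul_le_one₀ (by positivity)]
    exact h

lemma bddBelow_sampleCost {n : ℕ} (x : Fin n → diamBall N) :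
    BddBelow (sampleCost N p x '' centerSets N k) :=
  ⟨0, by rintro _ ⟨F, -, rfl⟩; exact sampleCost_nonneg x F⟩

lemma sampleOPT_mem_Icc (hk : 1 ≤ k) (hp : 1 ≤ p) {n : ℕ} (x : Fin n → diamBall N) :
    sampleOPT N k p x ∈ Set.Icc (0 : ℝ) 1 := by
  refine ⟨Real.sInf_nonneg (by rintro _ ⟨F, -, rfl⟩; exact sampleCost_nonneg x F), ?_⟩
  rcases (centerSets N k).eq_empty_or_nonempty with h | ⟨F, hF⟩
  · simp [sampleOPT, h]
  · exact (csInf_le (bddBelow_sampleCost x) ⟨F, hF, rfl⟩).trans (sampleCost_le_one hk hp hF x)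

lemma IsValueOracle.mem_Icc {β : ℝ} {A : (n : ℕ) → (Fin n → diamBall N) → ℝ}
    (hA : IsValueOracle N k p β A) (hk : 1 ≤ k) (hp : 1 ≤ p) (hβ : 1 ≤ β) {n : ℕ} (hn : 1 ≤ n)
    (x : Fin n → diamBall N) : A n x ∈ Set.Icc (0 : ℝ) 1 := by
  have h := hA.approx n hn x
  have h2 := sampleOPT_mem_Icc hk hp x
  exact ⟨(mul_nonneg (by positivity) h2.1).trans h.1, h.2.trans h2.2⟩

end Cost

/-! ### Finite nets of center sets -/

section Net

variable {d k : ℕ} {N : Seminorm ℝ (Fin d → ℝ)} {p : ℝ}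

/-- The cell of a point in the grid of side length `1 / L` of the cube `[-1/2, 1/2]^d`. -/
noncomputable def gridCell (L : ℕ) (x : Fin d → ℝ) : Fin d → Fin (L + 1) :=
  fun i => ⟨min ⌊(x i + 1 / 2) * L⌋₊ L, by omega⟩

lemma norm_sub_le_of_gridCell_eq (hN : IsClusteringNorm N) {L : ℕ} (hL : 0 < L)
    {x y : Fin d → ℝ} (hx : x ∈ diamBall N) (hy : y ∈ diamBall N)
    (h : gridCell L x = gridCell L y) : N (x - y) ≤ d / L := by
  have hL' : (0 : ℝ) < L := by exact_mod_cast hL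
  have key : ∀ z ∈ diamBall N, ∀ i, 0 ≤ (z i + 1 / 2) * L ∧ (z i + 1 / 2) * L ≤ L := by
    intro z hz i
    have := abs_le.1 ((hN.abs_apply_le z i).trans hz)
    constructor
    · exact mul_nonneg (by linarith) hL'.le
    · nlinarith
  have hi : ∀ i, |(x - y) i| ≤ 1 / L := by
    intro i
    have h1 := congrArg Fin.val (congrFun h i)
    have hx' := key x hx i
    have hy' := key y hy i
    -- Coordinates of points of the ball lie in `[-1/2, 1/2]`, so the truncation in `gridCell` is
    -- inactive.
    have hfx : ⌊(x i + 1 / 2) * L⌋₊ ≤ L := Nat.floor_le_of_le hx'.2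
    have hfy : ⌊(y i + 1 / 2) * L⌋₊ ≤ L := Nat.floor_le_of_le hy'.2
    simp only [gridCell, min_eq_left hfx, min_eq_left hfy] at h1
    have a1 := Nat.floor_le hx'.1
    have a2 := Nat.lt_floor_add_one ((x i + 1 / 2) * L)
    have b1 := Nat.floor_le hy'.1
    have b2 := Nat.lt_floor_add_one ((y i + 1 / 2) * L)
    rw [h1] at a1 a2
    have e : |(x - y) i| * L = |(x i - y i) * L| := by rw [abs_mul, abs_of_pos hL', Pi.sub_apply]
    rw [le_div_iff₀ hL', e, abs_le]
    constructor <;> linarith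
  calc N (x - y) ≤ ∑ i, |(x - y) i| := hN.le_sum_abs _
    _ ≤ ∑ _i : Fin d, 1 / (L : ℝ) := Finset.sum_le_sum fun i _ => hi i
    _ = d / L := by simp [div_eq_mul_inv]

/-- Only the set of occupied cells matters, not how many centers share a cell, because each center
needs just one nearby partner in the other set. -/
lemma distTo_le_of_image_gridCell_eq (hN : IsClusteringNorm N) {L : ℕ} (hL : 0 < L)
    {F G : Finset (Fin d → ℝ)} (hF : F.Nonempty) (hFb : ∀ f ∈ F, f ∈ diamBall N)
    (hGb : ∀ g ∈ G, g ∈ diamBall N) (h : F.image (gridCell L) = G.image (gridCell L))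
    (x : Fin d → ℝ) : distTo N x G ≤ distTo N x F + d / L := by
  obtain ⟨f, hf, e⟩ := exists_distTo_eq (N := N) hF x
  have h1 : gridCell L f ∈ G.image (gridCell L) := h ▸ Finset.mem_image_of_mem _ hf
  obtain ⟨g, hg, hfg⟩ := Finset.mem_image.1 h1
  rw [e]
  calc distTo N x G ≤ N (x - g) := distTo_le hg x
    _ = N ((x - f) + (f - g)) := by congr 1; abel
    _ ≤ N (x - f) + N (f - g) := map_add_le_add _ _ _
    _ ≤ _ := by
        gcongr
        exact norm_sub_le_of_gridCell_eq hN hL (hFb f hf) (hGb g hg) hfg.symm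

open Classical in
lemma exists_net (hN : IsClusteringNorm N) (hk : 1 ≤ k) (hp : 1 ≤ p) {L : ℕ} (hL : 0 < L) :
    ∃ S : Finset (Finset (Fin d → ℝ)), (∀ G ∈ S, G ∈ centerSets N k) ∧
      S.card ≤ (L + 1) ^ (d * k) ∧
      ∀ F ∈ centerSets N k, ∃ G ∈ S, ∀ x : diamBall N,
        |distTo N (x : Fin d → ℝ) F ^ p - distTo N (x : Fin d → ℝ) G ^ p| ≤ p * (d / L) := by
  rcases (centerSets N k).eq_empty_or_nonempty with h | ⟨F₀, hF₀⟩
  · exact ⟨∅, by simp, by simp, by simp [h]⟩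
  -- Grid points themselves would not do: rounding may merge centers, violating `F.card = k`, or
  -- leave the ball. Each pattern of occupied cells is instead represented by an admissible set
  -- realizing it; unrealized patterns get the dummy `F₀`.
  let rep : (Fin k → Fin d → Fin (L + 1)) → Finset (Fin d → ℝ) := fun c =>
    if h : ∃ F ∈ centerSets N k, F.image (gridCell L) = Finset.univ.image c then h.choose else F₀
  have hrep : ∀ c, rep c ∈ centerSets N k := by
    intro c
    simp only [rep]
    split_ifs with h
    · exact h.choose_spec.1
    · exact hF₀
  refine ⟨Finset.univ.image rep, ?_, ?_, ?_⟩
  · intro G hG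
    obtain ⟨c, -, rfl⟩ := Finset.mem_image.1 hG
    exact hrep c
  · refine Finset.card_image_le.trans (le_of_eq ?_)
    simp [pow_mul]
  · intro F hF
    let e : Fin k ≃ F := (finCongr hF.2.symm).trans F.equivFin.symm
    let c : Fin k → Fin d → Fin (L + 1) := fun j => gridCell L (e j : Fin d → ℝ)
    have hc : F.image (gridCell L) = Finset.univ.image c := by
      ext u
      simp only [Finset.mem_image, Finset.mem_univ, true_and, c]
      constructor
      · rintro ⟨f, hf, rfl⟩
        exact ⟨e.symm ⟨f, hf⟩, by simp⟩
      · rintro ⟨j, rfl⟩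
        exact ⟨e j, (e j).2, rfl⟩
    have hex : ∃ F ∈ centerSets N k, F.image (gridCell L) = Finset.univ.image c := ⟨F, hF, hc⟩
    have hG : (rep c).image (gridCell L) = F.image (gridCell L) := by
      simp only [rep, dif_pos hex]
      rw [hc]
      exact hex.choose_spec.2
    refine ⟨rep c, Finset.mem_image_of_mem _ (Finset.mem_univ _), fun x => ?_⟩
    refine (abs_rpow_sub_rpow_le hp (distTo_mem_Icc hk hF x)
      (distTo_mem_Icc hk (hrep c) x)).trans ?_
    refine mul_le_mul_of_nonneg_left ?_ (by linarith)
    have h1 := distTo_le_of_image_gridCell_eq hN hL (nonempty_of_mem_centerSets hk (hrep c))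
      (hrep c).1 hF.1 hG x
    have h2 := distTo_le_of_image_gridCell_eq hN hL (nonempty_of_mem_centerSets hk hF)
      hF.1 (hrep c).1 hG.symm x
    rw [abs_le]
    constructor <;> linarith

/-- If sample costs and statistical costs are close on a net of center sets, then so are the
optimal costs. -/
lemma abs_sampleOPT_sub_OPT_le (hN : IsClusteringNorm N) (hk : 1 ≤ k) (hp : 1 ≤ p)
    {P : Measure (diamBall N)} [IsProbabilityMeasure P] {α : ℝ} (hα : 0 < α)
    {S : Finset (Finset (Fin d → ℝ))} (hS : ∀ G ∈ S, G ∈ centerSets N k)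
    (hSnet : ∀ F ∈ centerSets N k, ∃ G ∈ S, ∀ x : diamBall N,
        |distTo N (x : Fin d → ℝ) F ^ p - distTo N (x : Fin d → ℝ) G ^ p| ≤ α / 4)
    {n : ℕ} (hn : 1 ≤ n) (x : Fin n → diamBall N)
    (hx : ∀ G ∈ S, |sampleCost N p x G - cost N p P G| ≤ α / 2) :
    |sampleOPT N k p x - OPT N k p P| ≤ α := by
  -- Without admissible center sets both optima are `sInf ∅ = 0`.
  rcases (centerSets N k).eq_empty_or_nonempty with h | hne
  · simp [sampleOPT, OPT, h, hα.le]
  have hcost : ∀ F ∈ centerSets N k, ∀ G ∈ centerSets N k, (∀ x : diamBall N,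
        |distTo N (x : Fin d → ℝ) F ^ p - distTo N (x : Fin d → ℝ) G ^ p| ≤ α / 4) →
        cost N p P G ≤ cost N p P F + α / 4 := by
    intro F hF G hG h
    have h1 : cost N p P G ≤ ∫ x : diamBall N, (distTo N (x : Fin d → ℝ) F ^ p + α / 4) ∂P := by
      refine integral_mono (integrable_distTo_rpow hN hk hp hG P)
        ((integrable_distTo_rpow hN hk hp hF P).add (integrable_const _)) fun x => ?_
      have := (abs_le.1 (h x)).1
      linarith
    rw [integral_add (integrable_distTo_rpow hN hk hp hF P) (integrable_const _)] at h1
    simpa [cost] using h1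
  have hsample : ∀ F G : Finset (Fin d → ℝ), (∀ x : diamBall N,
        |distTo N (x : Fin d → ℝ) F ^ p - distTo N (x : Fin d → ℝ) G ^ p| ≤ α / 4) →
        sampleCost N p x G ≤ sampleCost N p x F + α / 4 := by
    intro F G h
    have hn' : (0 : ℝ) < n := by exact_mod_cast hn
    have h1 : ∑ i, distTo N (x i : Fin d → ℝ) G ^ p ≤
        ∑ i, (distTo N (x i : Fin d → ℝ) F ^ p + α / 4) :=
      Finset.sum_le_sum fun i _ => by linarith [(abs_le.1 (h (x i))).1]
    rw [Finset.sum_add_distrib] at h1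
    simp only [Finset.sum_const, Finset.card_univ, Fintype.card_fin, nsmul_eq_mul] at h1
    calc sampleCost N p x G ≤ 1 / n * (∑ i, distTo N (x i : Fin d → ℝ) F ^ p + n * (α / 4)) :=
          mul_le_mul_of_nonneg_left h1 (by positivity)
      _ = _ := by rw [sampleCost]; field_simp
  rw [abs_le]
  constructor
  · have : OPT N k p P - α ≤ sampleOPT N k p x := by
      refine le_csInf (hne.image _) ?_
      rintro _ ⟨F, hF, rfl⟩
      obtain ⟨G, hG, hFG⟩ := hSnet F hF
      have h1 := hsample F G hFG
      have h2 := (abs_le.1 (hx G hG)).1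
      have h3 : OPT N k p P ≤ cost N p P G := csInf_le (bddBelow_cost P) ⟨G, hS G hG, rfl⟩
      linarith
    linarith
  -- A near-minimizer replaces a minimizer. The error budget is `α/4` for near-optimality, `α/4` for
  -- the passage to the net and `α/2` for sampling.
  · obtain ⟨_, ⟨F, hF, rfl⟩, hlt⟩ := exists_lt_of_csInf_lt (hne.image (cost N p P))
      (show sInf (cost N p P '' centerSets N k) < OPT N k p P + α / 4 by
        change OPT N k p P < _; linarith)
    obtain ⟨G, hG, hFG⟩ := hSnet F hF
    have h1 := hcost F hF G (hS G hG) hFG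
    have h2 := (abs_le.1 (hx G hG)).2
    have h3 : sampleOPT N k p x ≤ sampleCost N p x G :=
      csInf_le (bddBelow_sampleCost x) ⟨G, hS G hG, rfl⟩
    linarith

end Net

/-! ### Algorithms with a predetermined sequence of batch sizes -/

/-- Extension of a finite tuple of answers by zeros. -/
def extendZero {t : ℕ} (ξ : Fin t → ℝ) (s : ℕ) : ℝ := if h : s < t then ξ ⟨s, h⟩ else 0

lemma measurable_extendZero (t : ℕ) : Measurable (extendZero : (Fin t → ℝ) → ℕ → ℝ) := by
  refine measurable_pi_iff.2 fun s => ?_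
  by_cases h : s < t
  · simp [extendZero, h, measurable_pi_apply]
  · simp [extendZero, h]

open Classical in
/-- The algorithm whose `t`-th query is on `sz t` samples and which halts with output `V t` as
soon as the condition `H t` on the random string and the answers holds. -/
noncomputable def batchAlgorithm (sz : ℕ → ℕ) (H : ℕ → Set ((ℕ → Bool) × (ℕ → ℝ)))
    (V : ℕ → (ℕ → Bool) × (ℕ → ℝ) → ℝ) (hH : ∀ t, MeasurableSet (H t))
    (hV : ∀ t, Measurable (V t)) : OracleAlgorithm where
  next t z := if (z.1, extendZero z.2) ∈ H t then Sum.inr (V t (z.1, extendZero z.2))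
    else Sum.inl (sz t)
  measurable_next t := by
    have h : Measurable fun z : (ℕ → Bool) × (Fin t → ℝ) => (z.1, extendZero z.2) :=
      measurable_fst.prodMk ((measurable_extendZero t).comp measurable_snd)
    exact Measurable.ite (h (hH t)) (measurable_inr.comp ((hV t).comp h)) measurable_const

section Batch

variable {X : Type} {sz : ℕ → ℕ} {H : ℕ → Set ((ℕ → Bool) × (ℕ → ℝ))}
  {V : ℕ → (ℕ → Bool) × (ℕ → ℝ) → ℝ} {hH : ∀ t, MeasurableSet (H t)} {hV : ∀ t, Measurable (V t)}

/-- The number of samples used by the first `t` batches. -/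
def sampleCount (sz : ℕ → ℕ) (t : ℕ) : ℕ := ∑ s ∈ Finset.range t, sz s

/-- The answer of the oracle on the `t`-th batch. -/
def answer (sz : ℕ → ℕ) (A : (n : ℕ) → (Fin n → X) → ℝ) (x : ℕ → X) (t : ℕ) : ℝ :=
  A (sz t) fun i => x (sampleCount sz t + i)

lemma extendZero_apply_of_lt (y : ℕ → ℝ) {s t : ℕ} (h : s < t) :
    extendZero (fun j : Fin t => y j) s = y s := by simp [extendZero, h]

variable (hHloc : ∀ t r y y', (∀ s < t, y s = y' s) → ((r, y) ∈ H t ↔ (r, y') ∈ H t))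
  (hVloc : ∀ t r y y', (∀ s < t, y s = y' s) → (r, y) ∈ H t → V t (r, y) = V t (r, y'))

-- Batch sizes are fixed in advance, so the answers form one sequence `answer sz A x` that does not
-- depend on when the run halts. By locality, padding the known answers with zeros does not affect
-- the halting test.
include hHloc in
lemma batchAlgorithm_reaches_iff (A : (n : ℕ) → (Fin n → X) → ℝ) (x : ℕ → X) (r : ℕ → Bool)
    (t : ℕ) (ξ : Fin t → ℝ) (m : ℕ) :
    (batchAlgorithm sz H V hH hV).Reaches A x r t ξ m ↔
      m = sampleCount sz t ∧ (ξ = fun j : Fin t => answer sz A x j) ∧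
        ∀ s < t, (r, answer sz A x) ∉ H s := by
  have hiff : ∀ t, (r, extendZero fun j : Fin t => answer sz A x j) ∈ H t ↔
      (r, answer sz A x) ∈ H t :=
    fun t => hHloc t r _ _ fun s hs => extendZero_apply_of_lt _ hs
  constructor
  · intro h
    induction h with
    | start => exact ⟨by simp [sampleCount], Subsingleton.elim _ _, by simp⟩
    | query t ξ m n h hn ih =>
      obtain ⟨rfl, rfl, ih⟩ := ih
      simp only [batchAlgorithm] at hn
      split_ifs at hn with hh
      rw [hiff] at hh
      obtain rfl := Sum.inl.inj hn
      refine ⟨by simp [sampleCount, Finset.sum_range_succ], ?_, ?_⟩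
      · funext j
        refine Fin.lastCases ?_ (fun j => ?_) j
        · simp [answer]
        · simp
      · intro s hs
        rcases Nat.lt_succ_iff_lt_or_eq.1 hs with hs | rfl
        · exact ih s hs
        · exact hh
  · rintro ⟨rfl, rfl, h⟩
    induction t with
    | zero =>
      have := OracleAlgorithm.Reaches.start (alg := batchAlgorithm sz H V hH hV) (A := A)
        (x := x) (r := r)
      have e : (fun j : Fin 0 => answer sz A x j) = Fin.elim0 := Subsingleton.elim _ _
      simpa [e, sampleCount] using this
    | succ t ih =>
      have h1 := OracleAlgorithm.Reaches.query t _ _ (sz t)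
        (ih fun s hs => h s (hs.trans t.lt_succ_self)) (by
          simp only [batchAlgorithm]
          rw [if_neg]
          rw [hiff]
          exact h t t.lt_succ_self)
      have e1 : sampleCount sz (t + 1) = sampleCount sz t + sz t := by
        simp [sampleCount, Finset.sum_range_succ]
      rw [e1]
      convert h1 using 1
      funext j
      refine Fin.lastCases ?_ (fun j => ?_) j
      · simp [answer]
      · simp

-- Locality of `V t` is required only on `H t`: in the stage algorithm, `V t` for `t` inside stage 0
-- refers to answers not yet available.
include hHloc hVloc in
lemma batchAlgorithm_outputs_iff (A : (n : ℕ) → (Fin n → X) → ℝ) (x : ℕ → X) (r : ℕ → Bool)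
    (Λ : ℝ) (m : ℕ) :
    (batchAlgorithm sz H V hH hV).Outputs A x r Λ m ↔
      ∃ t, (∀ s < t, (r, answer sz A x) ∉ H s) ∧ (r, answer sz A x) ∈ H t ∧
        Λ = V t (r, answer sz A x) ∧ m = sampleCount sz t := by
  have hiff : ∀ t, (r, extendZero fun j : Fin t => answer sz A x j) ∈ H t ↔
      (r, answer sz A x) ∈ H t :=
    fun t => hHloc t r _ _ fun s hs => extendZero_apply_of_lt _ hs
  have hval : ∀ t, (r, answer sz A x) ∈ H t →
      V t (r, extendZero fun j : Fin t => answer sz A x j) = V t (r, answer sz A x) :=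
    fun t ht => (hVloc t r _ _ (fun s hs => (extendZero_apply_of_lt _ hs).symm) ht).symm
  constructor
  · rintro ⟨t, ξ, h, hn⟩
    obtain ⟨rfl, rfl, h'⟩ := (batchAlgorithm_reaches_iff hHloc A x r t ξ m).1 h
    simp only [batchAlgorithm] at hn
    split_ifs at hn with hh
    rw [hval t ((hiff t).1 hh)] at hn
    exact ⟨t, h', (hiff t).1 hh, (Sum.inr.inj hn).symm, rfl⟩
  · rintro ⟨t, h, ht, rfl, rfl⟩
    refine ⟨t, _, (batchAlgorithm_reaches_iff hHloc A x r t _ _).2 ⟨rfl, rfl, h⟩, ?_⟩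
    simp only [batchAlgorithm]
    rw [if_pos ((hiff t).2 ht), hval t ht]

end Batch

/-! ### Algorithms that work in stages -/

section Stages

/-- The number of queries in the stages before the `i`-th one. -/
def stageStart (m : ℕ → ℕ) (i : ℕ) : ℕ := ∑ j ∈ Finset.range i, m j

/-- The stage to which the `t`-th query belongs. -/
def stageOf (m : ℕ → ℕ) (t : ℕ) : ℕ := Nat.findGreatest (fun i => stageStart m i ≤ t) t

variable {m : ℕ → ℕ}

lemma stageStart_succ (i : ℕ) : stageStart m (i + 1) = stageStart m i + m i := by
  simp [stageStart, Finset.sum_range_succ]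

lemma stageStart_strictMono (hm : ∀ i, 0 < m i) : StrictMono (stageStart m) :=
  strictMono_nat_of_lt_succ fun i => by rw [stageStart_succ]; have := hm i; omega

/-- Stages are nonempty, so `i ≤ stageStart m i`, and the search bound `t` in `stageOf` excludes no
relevant stage. -/
lemma stageOf_stageStart_add (hm : ∀ i, 0 < m i) {i j : ℕ} (hj : j < m i) :
    stageOf m (stageStart m i + j) = i := by
  have h1 := (stageStart_strictMono hm).id_le
  refine Nat.findGreatest_eq_iff.2 ⟨(h1 i).trans (Nat.le_add_right _ _),
    fun _ => Nat.le_add_right _ _, fun l hl _ => ?_⟩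
  have h2 : stageStart m (i + 1) ≤ stageStart m l := (stageStart_strictMono hm).monotone hl
  rw [stageStart_succ] at h2
  omega

/-- The average of the answers to the queries of the `i`-th stage. -/
noncomputable def stageMean (m : ℕ → ℕ) (i : ℕ) (y : ℕ → ℝ) : ℝ :=
  (∑ j ∈ Finset.range (m i), y (stageStart m i + j)) / m i

lemma measurable_stageMean (m : ℕ → ℕ) (i : ℕ) : Measurable (stageMean m i) := by
  unfold stageMean
  fun_prop

lemma stageMean_congr {i : ℕ} {y y' : ℕ → ℝ} (h : ∀ s < stageStart m (i + 1), y s = y' s) :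
    stageMean m i y = stageMean m i y' := by
  rw [stageMean, stageMean]
  congr 1
  refine Finset.sum_congr rfl fun j hj => h _ ?_
  rw [stageStart_succ]
  have := Finset.mem_range.1 hj
  omega

/-- The algorithm that in its `i`-th stage queries the oracle on `m i` batches of `n i` samples,
computes the estimate `est i` from the random string and the mean of the answers, and halts if
this estimate is at least `thr i`. -/
noncomputable def stageAlgorithm (m n : ℕ → ℕ) (est : ℕ → (ℕ → Bool) × ℝ → ℝ) (thr : ℕ → ℝ)
    (hest : ∀ i, Measurable (est i)) : OracleAlgorithm :=
  batchAlgorithm (fun t => n (stageOf m t))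
    (fun t => {z | ∃ i, t = stageStart m (i + 1) ∧ thr i ≤ est i (z.1, stageMean m i z.2)})
    (fun t z => est (stageOf m t - 1) (z.1, stageMean m (stageOf m t - 1) z.2))
    (fun t => by
      simp only [Set.ofPred_exists]
      refine MeasurableSet.iUnion fun i => (MeasurableSet.const _).inter ?_
      exact measurableSet_le measurable_const ((hest i).comp
        (measurable_fst.prodMk ((measurable_stageMean m i).comp measurable_snd))))
    (fun t => (hest _).comp
        (measurable_fst.prodMk ((measurable_stageMean m _).comp measurable_snd)))

/-- The number of samples drawn in the stages before the `i`-th one. -/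
def stageSamples (m n : ℕ → ℕ) (i : ℕ) : ℕ := ∑ j ∈ Finset.range i, m j * n j

/-- The mean of the answers of the oracle in the `i`-th stage. -/
noncomputable def oracleMean {X : Type} (m n : ℕ → ℕ) (A : (n : ℕ) → (Fin n → X) → ℝ) (i : ℕ)
    (x : ℕ → X) : ℝ :=
  (∑ j ∈ Finset.range (m i), A (n i) fun l => x (stageSamples m n i + j * n i + l)) / m i

lemma sampleCount_stageStart_add {n : ℕ → ℕ} (hm : ∀ i, 0 < m i) (i j : ℕ) (hj : j ≤ m i) :
    sampleCount (fun t => n (stageOf m t)) (stageStart m i + j) =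
      stageSamples m n i + j * n i := by
  have step : ∀ i, ∀ j ≤ m i, sampleCount (fun t => n (stageOf m t)) (stageStart m i + j) =
      sampleCount (fun t => n (stageOf m t)) (stageStart m i) + j * n i := by
    intro i j hj
    induction j with
    | zero => simp
    | succ j ih =>
      have h := ih (by omega)
      rw [sampleCount, ← add_assoc, Finset.sum_range_succ, ← sampleCount, h,
        stageOf_stageStart_add hm (by omega)]
      ring
  rw [step i j hj]
  congr 1
  clear hj j
  induction i with
  | zero => simp [stageStart, sampleCount, stageSamples]
  | succ i ih =>
    rw [stageStart_succ, step i (m i) le_rfl, ih, stageSamples, stageSamples,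
      Finset.sum_range_succ]

lemma stageMean_answer {X : Type} {n : ℕ → ℕ} (hm : ∀ i, 0 < m i)
    (A : (n : ℕ) → (Fin n → X) → ℝ) (x : ℕ → X) (i : ℕ) :
    stageMean m i (answer (fun t => n (stageOf m t)) A x) = oracleMean m n A i x := by
  rw [stageMean, oracleMean]
  congr 1
  refine Finset.sum_congr rfl fun j hj => ?_
  have hj := Finset.mem_range.1 hj
  rw [answer, sampleCount_stageStart_add hm i j hj.le, stageOf_stageStart_add hm hj]

lemma stageAlgorithm_outputs_iff {X : Type} {n : ℕ → ℕ} {est : ℕ → (ℕ → Bool) × ℝ → ℝ}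
    {thr : ℕ → ℝ} {hest : ∀ i, Measurable (est i)} (hm : ∀ i, 0 < m i)
    (A : (n : ℕ) → (Fin n → X) → ℝ) (x : ℕ → X) (r : ℕ → Bool) (Λ : ℝ) (M : ℕ) :
    (stageAlgorithm m n est thr hest).Outputs A x r Λ M ↔
      ∃ i, (∀ j < i, est j (r, oracleMean m n A j x) < thr j) ∧
        thr i ≤ est i (r, oracleMean m n A i x) ∧ Λ = est i (r, oracleMean m n A i x) ∧
        M = stageSamples m n (i + 1) := by
  have hinj := (stageStart_strictMono hm).injective
  -- The test on stage `i` takes place just before the first query of stage `i + 1`, hence the shift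
  -- by one.
  have hst : ∀ i, stageOf m (stageStart m (i + 1)) - 1 = i := fun i => by
    have := stageOf_stageStart_add hm (hm (i + 1))
    rw [add_zero] at this
    rw [this, Nat.add_sub_cancel]
  have hcount : ∀ i, sampleCount (fun t => n (stageOf m t)) (stageStart m (i + 1)) =
      stageSamples m n (i + 1) := fun i => by
    simpa using sampleCount_stageStart_add (n := n) hm (i + 1) 0 (Nat.zero_le _)
  rw [stageAlgorithm, batchAlgorithm_outputs_iff]
  · constructor
    · rintro ⟨t, h1, ⟨i, rfl, h2⟩, rfl, rfl⟩
      simp only [hst, stageMean_answer hm] at h2 ⊢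
      refine ⟨i, fun j hj => ?_, h2, rfl, hcount i⟩
      have h3 := h1 _ (stageStart_strictMono hm (Nat.succ_lt_succ hj))
      by_contra hcon
      exact h3 ⟨j, rfl, by simpa only [stageMean_answer hm] using not_lt.1 hcon⟩
    · rintro ⟨i, h1, h2, rfl, rfl⟩
      refine ⟨stageStart m (i + 1), ?_, ⟨i, rfl, ?_⟩, ?_, (hcount i).symm⟩
      · rintro s hs ⟨j, rfl, hj⟩
        simp only [stageMean_answer hm] at hj
        have hji := (stageStart_strictMono hm).lt_iff_lt.1 hs
        exact absurd (h1 j (by omega)) (not_lt.2 hj)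
      · simpa only [stageMean_answer hm] using h2
      · simp only [hst, stageMean_answer hm]
  · intro t r y y' h
    have key : ∀ i, t = stageStart m (i + 1) → stageMean m i y = stageMean m i y' := by
      rintro i rfl
      exact stageMean_congr h
    constructor
    · rintro ⟨i, hi, h2⟩
      exact ⟨i, hi, by simpa only [key i hi] using h2⟩
    · rintro ⟨i, hi, h2⟩
      exact ⟨i, hi, by simpa only [key i hi] using h2⟩
  · rintro t r y y' h ⟨i, rfl, -⟩
    simp only [hst, stageMean_congr h]

end Stages

open ProbabilityTheory

/-! ### Concentration on streams of i.i.d. samples -/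

section Stream

variable {X : Type} [MeasurableSpace X] (P : Measure X) [IsProbabilityMeasure P]

instance : IsProbabilityMeasure (iidStream P) := by unfold iidStream; infer_instance

instance : IsProbabilityMeasure coins := by unfold coins; infer_instance

lemma measurePreserving_block (o n : ℕ) :
    MeasurePreserving (fun (x : ℕ → X) (l : Fin n) => x (o + l)) (iidStream P)
      (Measure.infinitePi fun _ : Fin n => P) := by
  refine ⟨by fun_prop, ?_⟩
  exact Measure.map_infinitePi_infinitePi_of_inj (P := fun _ : ℕ => P)
    (f := fun l : Fin n => o + (l : ℕ)) fun a b h => Fin.ext (by simpa using h)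

lemma iIndepFun_eval_iidStream : iIndepFun (fun i (x : ℕ → X) => x i) (iidStream P) :=
  iIndepFun_infinitePi (X := fun _ ω => ω) fun _ => measurable_id

lemma indepFun_block {o n o' n' : ℕ} (h : o + n ≤ o') :
    IndepFun (fun (x : ℕ → X) (l : Fin n) => x (o + l))
      (fun (x : ℕ → X) (l : Fin n') => x (o' + l)) (iidStream P) := by
  have h1 := (iIndepFun_eval_iidStream P).indepFun_finset (Finset.Ico o (o + n))
    (Finset.Ico o' (o' + n')) (by
      rw [Finset.disjoint_left]
      intro a ha hb
      simp only [Finset.mem_Ico] at ha hb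
      omega) fun i => measurable_pi_apply i
  exact h1.comp
    (φ := fun a (l : Fin n) => a ⟨o + l, by simp⟩) (ψ := fun a (l : Fin n') => a ⟨o' + l, by simp⟩)
    (measurable_pi_iff.2 fun _ => measurable_pi_apply _)
    (measurable_pi_iff.2 fun _ => measurable_pi_apply _)

/-- Chebyshev's inequality for the mean of a function over consecutive blocks of samples. -/
lemma measure_blockMean_le {n : ℕ} {f : (Fin n → X) → ℝ} (hf : Measurable f)
    (hf01 : ∀ x, f x ∈ Set.Icc (0 : ℝ) 1) (o : ℕ) {m : ℕ} (hm : 0 < m) {τ : ℝ} (hτ : 0 < τ) :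
    iidStream P {x | τ ≤ |(∑ j ∈ Finset.range m, f fun l => x (o + j * n + l)) / m -
        ∫ y, f y ∂(Measure.infinitePi fun _ : Fin n => P)|} ≤
      ENNReal.ofReal (1 / (m * τ ^ 2)) := by
  set Y : ℕ → (ℕ → X) → ℝ := fun j x => f fun l => x (o + j * n + l) with hY
  have hYm : ∀ j, Measurable (Y j) := fun j => hf.comp (by fun_prop)
  have hYL : ∀ j, MemLp (Y j) 2 (iidStream P) := fun j =>
    memLp_of_bounded (a := 0) (b := 1) (Filter.Eventually.of_forall fun x => hf01 _)
      (hYm j).aestronglyMeasurable 2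
  have hYE : ∀ j, ∫ x, Y j x ∂(iidStream P) =
      ∫ y, f y ∂(Measure.infinitePi fun _ : Fin n => P) := fun j => by
    have h := measurePreserving_block P (o + j * n) n
    rw [← h.map_eq, integral_map h.measurable.aemeasurable hf.aestronglyMeasurable]
  have hYV : ∀ j, Var[Y j; iidStream P] ≤ 1 := fun j => by
    have := variance_le_sq_of_bounded (μ := iidStream P) (a := 0) (b := 1) (X := Y j)
      (Filter.Eventually.of_forall fun x => hf01 _) (hYm j).aemeasurable
    norm_num at this
    linarith
  have hind : ∀ i j, i < j → IndepFun (Y i) (Y j) (iidStream P) := fun i j hij => by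
    have h : o + i * n + n ≤ o + j * n := by nlinarith
    exact (indepFun_block P (n' := n) h).comp hf hf
  have hvar : Var[∑ j ∈ Finset.range m, Y j; iidStream P] ≤ m := by
    rw [IndepFun.variance_sum (fun i _ => hYL i)]
    · simpa using Finset.sum_le_sum fun j (_ : j ∈ Finset.range m) => hYV j
    · intro i _ j _ hij
      rcases lt_or_gt_of_ne hij with h | h
      · exact hind i j h
      · exact (hind j i h).symm
  have hm' : (0 : ℝ) < m := by exact_mod_cast hm
  have hc := meas_ge_le_variance_div_sq (μ := iidStream P) (X := ∑ j ∈ Finset.range m, Y j)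
    (memLp_finsetSum' _ fun i _ => hYL i) (c := m * τ) (by positivity)
  have hE : ∫ x, (∑ j ∈ Finset.range m, Y j) x ∂(iidStream P) =
      m * ∫ y, f y ∂(Measure.infinitePi fun _ : Fin n => P) := by
    simp only [Finset.sum_apply]
    rw [integral_finsetSum _ fun i _ => (hYL i).integrable (by norm_num)]
    simp [hYE]
  rw [hE] at hc
  refine (measure_mono ?_).trans (hc.trans (ENNReal.ofReal_le_ofReal ?_))
  · intro x hx
    simp only [Set.mem_ofPred_eq, Finset.sum_apply] at hx ⊢
    have e : (∑ j ∈ Finset.range m, Y j x) -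
        m * ∫ y, f y ∂(Measure.infinitePi fun _ : Fin n => P) =
        m * ((∑ j ∈ Finset.range m, f fun l => x (o + j * n + l)) / m -
          ∫ y, f y ∂(Measure.infinitePi fun _ : Fin n => P)) := by
      field_simp
      rfl
    rw [e, abs_mul, abs_of_pos hm']
    exact mul_le_mul_of_nonneg_left hx hm'.le
  · calc _ ≤ (m : ℝ) / (m * τ) ^ 2 := by gcongr
      _ = _ := by field_simp

lemma measure_sum_sub_integral_ge_le {g : X → ℝ} (hg : Measurable g)
    (hg01 : ∀ x, g x ∈ Set.Icc (0 : ℝ) 1) (o n : ℕ) (hn : 0 < n) {τ : ℝ} (hτ : 0 ≤ τ) :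
    iidStream P {x | τ ≤ 1 / (n : ℝ) * ∑ l : Fin n, g (x (o + l)) - ∫ y, g y ∂P} ≤
      ENNReal.ofReal (Real.exp (-2 * n * τ ^ 2)) := by
  have hn' : (0 : ℝ) < n := by exact_mod_cast hn
  have hE : ∀ l : Fin n, ∫ x, g (x (o + l)) ∂(iidStream P) = ∫ y, g y ∂P := fun l => by
    have h : MeasurePreserving (Function.eval (o + (l : ℕ))) (iidStream P) P :=
      measurePreserving_eval_infinitePi (fun _ : ℕ => P) (o + l)
    have h2 := integral_map (μ := iidStream P) h.measurable.aemeasurable (f := g) hg.aestronglyMeasurable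
    rw [h.map_eq] at h2
    exact h2.symm
  have hind : iIndepFun (fun (l : Fin n) (x : ℕ → X) => g (x (o + l)) - ∫ y, g y ∂P)
      (iidStream P) :=
    ((iIndepFun_eval_iidStream P).precomp (g := fun l : Fin n => o + (l : ℕ))
      fun a b h => Fin.ext (by simpa using h)).comp (fun _ a => g a - ∫ y, g y ∂P)
      fun _ => hg.sub_const _
  -- Hoeffding's lemma: a variable with values in `[0, 1]` has variance proxy `1/4`, which yields
  -- the exponent `-2nτ²`.
  have hsub : ∀ l ∈ (Finset.univ : Finset (Fin n)), HasSubgaussianMGF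
      (fun x : ℕ → X => g (x (o + l)) - ∫ y, g y ∂P) ((‖(1 : ℝ) - 0‖₊ / 2) ^ 2)
      (iidStream P) := fun l _ => by
    rw [← hE l]
    exact hasSubgaussianMGF_of_mem_Icc (hg.comp (measurable_pi_apply _)).aemeasurable
      (Filter.Eventually.of_forall fun x => hg01 _)
  have h := HasSubgaussianMGF.measure_sum_ge_le_of_iIndepFun hind hsub (ε := n * τ)
    (by positivity)
  rw [← ENNReal.ofReal_toReal (measure_ne_top (iidStream P) _)]
  refine ENNReal.ofReal_le_ofReal ?_
  refine le_trans (measureReal_mono ?_) (h.trans (le_of_eq ?_))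
  · intro x hx
    simp only [Set.mem_ofPred_eq, Finset.sum_sub_distrib, Finset.sum_const, Finset.card_univ,
      Fintype.card_fin, nsmul_eq_mul] at hx ⊢
    have := mul_le_mul_of_nonneg_left hx hn'.le
    rw [mul_sub, ← mul_assoc, mul_one_div_cancel hn'.ne', one_mul] at this
    exact this
  · congr 1
    simp
    field_simp

/-- Hoeffding's inequality for a block of samples. -/
lemma measure_abs_sum_sub_integral_ge_le {g : X → ℝ} (hg : Measurable g)
    (hg01 : ∀ x, g x ∈ Set.Icc (0 : ℝ) 1) (o n : ℕ) (hn : 0 < n) {τ : ℝ} (hτ : 0 ≤ τ) :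
    iidStream P {x | τ ≤ |1 / (n : ℝ) * ∑ l : Fin n, g (x (o + l)) - ∫ y, g y ∂P|} ≤
      ENNReal.ofReal (2 * Real.exp (-2 * n * τ ^ 2)) := by
  have hn' : (0 : ℝ) < n := by exact_mod_cast hn
  have h1 := measure_sum_sub_integral_ge_le P hg hg01 o n hn hτ
  -- The lower tail of `g` is the upper tail of `1 - g`.
  have h2 := measure_sum_sub_integral_ge_le P (g := fun x => 1 - g x) (measurable_const.sub hg)
    (fun x => ⟨by linarith [(hg01 x).2], by linarith [(hg01 x).1]⟩) o n hn hτ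
  have hint : ∫ y, (1 - g y) ∂P = 1 - ∫ y, g y ∂P := by
    rw [integral_sub (integrable_const _)
      (Integrable.of_mem_Icc 0 1 hg.aemeasurable (Filter.Eventually.of_forall hg01))]
    simp
  rw [two_mul, ENNReal.ofReal_add (Real.exp_pos _).le (Real.exp_pos _).le]
  refine (measure_mono ?_).trans ((measure_union_le _ _).trans (add_le_add h1 h2))
  intro x hx
  simp only [Set.mem_ofPred_eq, Set.mem_union] at hx ⊢
  rcases le_abs.1 hx with h | h
  · exact Or.inl h
  · refine Or.inr (h.trans (le_of_eq ?_))
    rw [hint, Finset.sum_sub_distrib]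
    simp only [Finset.sum_const, Finset.card_univ, Fintype.card_fin, nsmul_eq_mul, mul_one]
    rw [mul_sub, one_div_mul_cancel hn'.ne']
    ring

end Stream

/-- The optimal sample cost of a block of samples is close to the optimal statistical cost. -/
lemma measure_sampleOPT_deviation_le {d k : ℕ} {N : Seminorm ℝ (Fin d → ℝ)} {p : ℝ}
    (hN : IsClusteringNorm N) (hk : 1 ≤ k) (hp : 1 ≤ p) (P : Measure (diamBall N))
    [IsProbabilityMeasure P] {α : ℝ} (hα : 0 < α) {L : ℕ} (hL : 0 < L)
    (hLα : p * (d / L) ≤ α / 4) (o : ℕ) {n : ℕ} (hn : 1 ≤ n) :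
    iidStream P {x | ¬ |sampleOPT N k p (fun l : Fin n => x (o + l)) - OPT N k p P| ≤ α} ≤
      ENNReal.ofReal ((L + 1) ^ (d * k) * (2 * Real.exp (-(n * α ^ 2 / 2)))) := by
  obtain ⟨S, hS, hcard, hnet⟩ := exists_net (d := d) hN hk hp hL
  have h1 : ∀ G ∈ S, iidStream P {x | α / 2 ≤
      |sampleCost N p (fun l : Fin n => x (o + l)) G - cost N p P G|} ≤
      ENNReal.ofReal (2 * Real.exp (-(n * α ^ 2 / 2))) := fun G hG => by
    have h := measure_abs_sum_sub_integral_ge_le P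
      (measurable_distTo_rpow hN hp (nonempty_of_mem_centerSets hk (hS G hG)))
      (distTo_rpow_mem_Icc hk hp (hS G hG)) o n hn (half_pos hα).le
    have e : -2 * (n : ℝ) * (α / 2) ^ 2 = -(n * α ^ 2 / 2) := by ring
    rw [e] at h
    exact h
  calc iidStream P {x | ¬ |sampleOPT N k p (fun l : Fin n => x (o + l)) - OPT N k p P| ≤ α}
      ≤ iidStream P (⋃ G ∈ S, {x | α / 2 ≤
          |sampleCost N p (fun l : Fin n => x (o + l)) G - cost N p P G|}) := by
        refine measure_mono fun x hx => ?_
        by_contra hcon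
        simp only [Set.mem_iUnion, Set.mem_ofPred_eq, not_exists, not_le] at hcon
        refine hx (abs_sampleOPT_sub_OPT_le hN hk hp hα hS (fun F hF => ?_) hn _
          fun G hG => (hcon G hG).le)
        obtain ⟨G, hG, h⟩ := hnet F hF
        exact ⟨G, hG, fun x => (h x).trans hLα⟩
    _ ≤ ∑ G ∈ S, ENNReal.ofReal (2 * Real.exp (-(n * α ^ 2 / 2))) :=
        (measure_biUnion_finset_le _ _).trans (Finset.sum_le_sum h1)
    _ = ENNReal.ofReal (S.card * (2 * Real.exp (-(n * α ^ 2 / 2)))) := by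
        rw [Finset.sum_const, nsmul_eq_mul, ENNReal.ofReal_mul (Nat.cast_nonneg _)]
        simp
    _ ≤ _ := by
        refine ENNReal.ofReal_le_ofReal ?_
        gcongr
        exact_mod_cast hcard

/-! ### Randomized rounding -/

/-- The number with binary digits the first `q` bits of a string. -/
def coinNat (q : ℕ) (r : ℕ → Bool) : ℕ := Nat.ofBits fun i : Fin q => r i

/-- A value of `coinNat q` prescribes the first `q` bits through its binary digits, so it has
probability at most `2^(-q)`. -/
lemma coins_coinNat_mem_le (q : ℕ) (S : Finset ℕ) :
    coins {r | coinNat q r ∈ S} ≤ ENNReal.ofReal (S.card / 2 ^ q) := by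
  have h1 : ∀ v : ℕ, coins {r | coinNat q r = v} ≤ ENNReal.ofReal (1 / 2 ^ q) := fun v => by
    calc coins {r | coinNat q r = v}
        ≤ coins ((Finset.range q : Set ℕ).pi fun i => {v.testBit i}) := by
          refine measure_mono fun r hr i hi => ?_
          have hi' : i < q := by simpa using hi
          simp only [Set.mem_ofPred_eq] at hr
          rw [Set.mem_singleton_iff, ← hr, coinNat, Nat.testBit_ofBits_lt _ _ hi']
      _ = ENNReal.ofReal (1 / 2 ^ q) := by
          rw [coins, Measure.infinitePi_pi _ fun i _ => MeasurableSet.singleton _]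
          simp only [PMF.toMeasure_apply_singleton _ _ (MeasurableSet.singleton _),
            PMF.uniformOfFintype_apply, Fintype.card_bool, Finset.prod_const, Finset.card_range]
          rw [ENNReal.ofReal_div_of_pos (by positivity), ENNReal.ofReal_pow (by norm_num)]
          simp [ENNReal.inv_pow]
  calc coins {r | coinNat q r ∈ S} ≤ coins (⋃ v ∈ S, {r | coinNat q r = v}) := by
        refine measure_mono fun r hr => ?_
        simpa using hr
    _ ≤ ∑ v ∈ S, ENNReal.ofReal (1 / 2 ^ q) :=
        (measure_biUnion_finset_le _ _).trans (Finset.sum_le_sum fun v _ => h1 v)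
    _ = ENNReal.ofReal (S.card / 2 ^ q) := by
        rw [Finset.sum_const, nsmul_eq_mul, ← ENNReal.ofReal_natCast,
          ← ENNReal.ofReal_mul (Nat.cast_nonneg _)]
        congr 1
        ring

/-- Rounding down to a grid of width `α` with a random offset. -/
noncomputable def randomRound (α : ℝ) (q : ℕ) (z : (ℕ → Bool) × ℝ) : ℝ :=
  α * (⌊z.2 / α - coinNat q z.1 / 2 ^ q⌋ + coinNat q z.1 / 2 ^ q)

lemma measurable_coinNat (q : ℕ) : Measurable (coinNat q) :=
  (measurable_of_countable (Nat.ofBits (n := q))).comp (by fun_prop)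

lemma measurable_randomRound (α : ℝ) (q : ℕ) : Measurable (randomRound α q) := by
  have h : Measurable fun z : (ℕ → Bool) × ℝ => (coinNat q z.1 : ℝ) :=
    (measurable_of_countable (Nat.cast : ℕ → ℝ)).comp ((measurable_coinNat q).comp measurable_fst)
  have h2 : Measurable fun z : (ℕ → Bool) × ℝ => ⌊z.2 / α - (coinNat q z.1 : ℝ) / 2 ^ q⌋ :=
    ((measurable_snd.div_const _).sub (h.div_const _)).floor
  exact (((measurable_of_countable (Int.cast : ℤ → ℝ)).comp h2).add (h.div_const _)).const_mul _

lemma randomRound_mem_Ioc {α : ℝ} (hα : 0 < α) (q : ℕ) (r : ℕ → Bool) (y : ℝ) :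
    randomRound α q (r, y) ∈ Set.Ioc (y - α) y := by
  have h1 := Int.floor_le (y / α - coinNat q r / 2 ^ q)
  have h2 := Int.lt_floor_add_one (y / α - coinNat q r / 2 ^ q)
  have e : α * (y / α) = y := by field_simp
  simp only [randomRound]
  constructor
  · nlinarith
  · nlinarith

/-- Random rounding gives the same result on all numbers close to a given one, except with small
probability. -/
lemma coins_randomRound_ne_le {α τ : ℝ} (hα : 0 < α) (hτ : 0 ≤ τ) (q : ℕ) (E : ℝ) :
    coins {r | ∃ y y', |y - E| ≤ τ ∧ |y' - E| ≤ τ ∧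
        randomRound α q (r, y) ≠ randomRound α q (r, y')} ≤
      ENNReal.ofReal (2 * τ / α + 1 / 2 ^ q) := by
  have hQ : (0 : ℝ) < 2 ^ q := by positivity
  set a : ℝ := 2 ^ q * (E / α)
  set R : ℝ := 2 ^ q * (τ / α)
  have hR : 0 ≤ R := by positivity
  -- If two values within `τ` of `E` are rounded differently, a grid point `α (z + J / 2^q)` lies
  -- within `τ` of `E`. Scaled by `2^q / α` it is an integer in `[a - R, a + R]` with residue `J`
  -- modulo `2^q`. So the bad offsets `J` are among the at most `2R + 1` residues in `S`.
  set S : Finset ℕ := (Finset.Icc ⌈a - R⌉ ⌊a + R⌋).image fun w => (w % 2 ^ q).toNat with hS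
  have hcard : (S.card : ℝ) ≤ 2 * R + 1 := by
    have h1 : (S.card : ℝ) ≤ ((⌊a + R⌋ + 1 - ⌈a - R⌉).toNat : ℝ) := by
      have := Finset.card_image_le (s := Finset.Icc ⌈a - R⌉ ⌊a + R⌋)
        (f := fun w : ℤ => (w % 2 ^ q).toNat)
      rw [Int.card_Icc] at this
      exact_mod_cast this
    refine h1.trans ?_
    have h2 : (((⌊a + R⌋ + 1 - ⌈a - R⌉).toNat : ℤ) : ℝ) =
        max ((⌊a + R⌋ + 1 - ⌈a - R⌉ : ℤ) : ℝ) 0 := by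
      rw [Int.toNat_eq_max]; push_cast; rfl
    rw [Int.cast_natCast] at h2
    rw [h2]
    refine max_le ?_ (by positivity)
    push_cast
    linarith [Int.floor_le (a + R), Int.le_ceil (a - R)]
  have hkey : ∀ (r : ℕ → Bool) (y y' : ℝ), |y - E| ≤ τ → |y' - E| ≤ τ →
      ⌊y / α - coinNat q r / 2 ^ q⌋ < ⌊y' / α - coinNat q r / 2 ^ q⌋ → coinNat q r ∈ S := by
    intro r y y' hy hy' hlt
    set J := coinNat q r with hJ
    set z := ⌊y' / α - J / 2 ^ q⌋ with hz
    have hJlt : J < 2 ^ q := Nat.ofBits_lt_two_pow _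
    have h1 : y / α - J / 2 ^ q < z := Int.floor_lt.1 hlt
    have h2 : (z : ℝ) ≤ y' / α - J / 2 ^ q := Int.floor_le _
    have h3 : E / α - τ / α ≤ y / α := by
      rw [← sub_div]; gcongr; linarith [(abs_le.1 hy).1]
    have h4 : y' / α ≤ E / α + τ / α := by
      rw [← add_div]; gcongr; linarith [(abs_le.1 hy').2]
    have e : (2 : ℝ) ^ q * (J / 2 ^ q) = J := by field_simp
    refine Finset.mem_image.2 ⟨2 ^ q * z + J, Finset.mem_Icc.2 ⟨?_, ?_⟩, ?_⟩
    · rw [Int.ceil_le]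
      push_cast
      have := mul_le_mul_of_nonneg_left (show E / α - τ / α ≤ z + J / 2 ^ q by linarith) hQ.le
      rw [mul_sub, mul_add, e] at this
      exact this
    · rw [Int.le_floor]
      push_cast
      have := mul_le_mul_of_nonneg_left (show z + J / 2 ^ q ≤ E / α + τ / α by linarith) hQ.le
      rw [mul_add, mul_add, e] at this
      exact this
    · have : ((2 : ℤ) ^ q * z + J) % 2 ^ q = J := by
        rw [Int.mul_add_emod_self_left]
        exact Int.emod_eq_of_lt (by positivity) (by exact_mod_cast hJlt)
      simp only [this, Int.toNat_natCast]
  refine (measure_mono ?_).trans ((coins_coinNat_mem_le q S).trans (ENNReal.ofReal_le_ofReal ?_))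
  · rintro r ⟨y, y', hy, hy', hne⟩
    rcases lt_trichotomy ⌊y / α - coinNat q r / 2 ^ q⌋ ⌊y' / α - coinNat q r / 2 ^ q⌋
      with h | h | h
    · exact hkey r y y' hy hy' h
    · exact absurd (by simp only [randomRound, h]) hne
    · exact hkey r y' y hy' hy h
  · calc (S.card : ℝ) / 2 ^ q ≤ (2 * R + 1) / 2 ^ q := by gcongr
      _ = _ := by simp only [R]; field_simp

/-! ### The estimator -/

/-- The number of queries in the `i`-th stage. -/
noncomputable def queryCount (ρ : ℝ) (i : ℕ) : ℕ := ⌈2048 * (2 ^ i) ^ 7 / ρ ^ 3⌉₊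

/-- The number of samples for each query in the `i`-th stage. -/
noncomputable def batchSize (d k : ℕ) (p δ : ℝ) (i : ℕ) : ℕ :=
  ⌈56 * (d : ℝ) ^ 2 * k * (2 ^ i) ^ 5 * Real.log (p / δ)⌉₊

/-- The accuracy of the `i`-th stage. -/
noncomputable def gridWidth (i : ℕ) : ℝ := 1 / (2 ^ i) ^ 2

/-- The number of random bits used in the `i`-th stage. -/
noncomputable def coinCount (ρ : ℝ) (i : ℕ) : ℕ := ⌈8 * 2 ^ i / ρ⌉₊

/-- The algorithm that estimates the optimal cost with accuracy `gridWidth i` in stage `i`, and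
halts when the estimate is large compared to the accuracy. -/
noncomputable def optEstimator (d k : ℕ) (p β ε ρ δ : ℝ) : OracleAlgorithm :=
  stageAlgorithm (queryCount ρ) (batchSize d k p δ)
    (fun i => randomRound (gridWidth i) (coinCount ρ i))
    (fun i => (4 * β / ε + 1) * gridWidth i) fun _ => measurable_randomRound _ _

lemma gridWidth_pos (i : ℕ) : 0 < gridWidth i := by unfold gridWidth; positivity

lemma one_le_two_pow_real (i : ℕ) : (1 : ℝ) ≤ 2 ^ i := one_le_pow₀ (by norm_num)

lemma queryCount_pos {ρ : ℝ} (hρ : 0 < ρ) (i : ℕ) : 0 < queryCount ρ i :=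
  Nat.ceil_pos.2 (by positivity)

lemma one_le_log_div {p δ : ℝ} (hp : 1 ≤ p) (hδ : 0 < δ) (hδ' : δ < 1 / 3) :
    1 ≤ Real.log (p / δ) := by
  rw [Real.le_log_iff_exp_le (by positivity), le_div_iff₀ hδ]
  nlinarith [Real.exp_one_lt_d9, Real.exp_pos 1]

lemma batchSize_pos {d k : ℕ} {p δ : ℝ} (hd : 1 ≤ d) (hk : 1 ≤ k) (hp : 1 ≤ p) (hδ : 0 < δ)
    (hδ' : δ < 1 / 3) (i : ℕ) : 1 ≤ batchSize d k p δ i := by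
  have h1 := one_le_log_div hp hδ hδ'
  have h2 : (0 : ℝ) < d := by exact_mod_cast hd
  have h3 : (0 : ℝ) < k := by exact_mod_cast hk
  exact Nat.ceil_pos.2 (by positivity)

/-! ### Replicability -/

section Replicable

/-- The set `s` may be non-measurable, so the failure events, which involve infima over center sets
and existential quantifiers over reals, need no measurability proof. -/
lemma measure_prod_fst_le {X Y : Type*} [MeasurableSpace X] [MeasurableSpace Y] (μ : Measure X)
    (ν : Measure Y) [IsProbabilityMeasure ν] (s : Set X) :
    (μ.prod ν) {w | w.1 ∈ s} ≤ μ s := by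
  have h : {w : X × Y | w.1 ∈ s} = s ×ˢ Set.univ := by ext; simp
  rw [h, Measure.prod_prod]
  simp

lemma measure_prod_snd_le {X Y : Type*} [MeasurableSpace X] [MeasurableSpace Y] (μ : Measure X)
    [IsProbabilityMeasure μ] (ν : Measure Y) [SFinite ν] (s : Set Y) :
    (μ.prod ν) {w | w.2 ∈ s} ≤ ν s := by
  have h : {w : X × Y | w.2 ∈ s} = Set.univ ×ˢ s := by ext; simp
  rw [h, Measure.prod_prod]
  simp

/-- A union bound over events with geometrically decreasing probabilities. -/
lemma measure_iUnion_le_ofReal_of_geometric {X : Type*} [MeasurableSpace X] {μ : Measure X}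
    {B : ℕ → Set X} {a : ℝ} (ha : 0 ≤ a) (h : ∀ i, μ (B i) ≤ ENNReal.ofReal (a / 2 / 2 ^ i)) :
    μ (⋃ i, B i) ≤ ENNReal.ofReal a := by
  refine (measure_iUnion_le _).trans ((ENNReal.tsum_le_tsum h).trans (le_of_eq ?_))
  rw [← ENNReal.ofReal_tsum_of_nonneg (fun i => by positivity) (summable_geometric_two' a),
    tsum_geometric_two']

/-- With `t = 2^i`, the budget `ρ / (2t)` splits into four equal parts `ρ / (8t)`: Chebyshev for
each of the two executions, the rounding loss `2τ/α`, and the discreteness `2^(-q)` of the offset.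
The number `2048 t^7 / ρ^3` of queries is what Chebyshev needs at `τ = ρ / (16 t^3)`. -/
lemma stage_failure_le {ρ : ℝ} (hρ : 0 < ρ) (i : ℕ) :
    1 / (queryCount ρ i * (ρ / 2 / 2 ^ i * gridWidth i / 8) ^ 2) +
      (1 / (queryCount ρ i * (ρ / 2 / 2 ^ i * gridWidth i / 8) ^ 2) +
      (2 * (ρ / 2 / 2 ^ i * gridWidth i / 8) / gridWidth i + 1 / 2 ^ coinCount ρ i)) ≤
      ρ / 2 / 2 ^ i := by
  have ht : (0 : ℝ) < 2 ^ i := by positivity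
  have hm : 2048 * (2 ^ i) ^ 7 / ρ ^ 3 ≤ (queryCount ρ i : ℝ) := Nat.le_ceil _
  have hq : 8 * 2 ^ i / ρ ≤ (coinCount ρ i : ℝ) := Nat.le_ceil _
  have hq2 : 8 * 2 ^ i / ρ ≤ (2 : ℝ) ^ coinCount ρ i :=
    hq.trans (by exact_mod_cast (Nat.lt_two_pow_self (n := coinCount ρ i)).le)
  rw [gridWidth]
  generalize (2 : ℝ) ^ i = t at *
  have h1 : 1 / (queryCount ρ i * (ρ / 2 / t * (1 / t ^ 2) / 8) ^ 2) ≤ ρ / 8 / t := by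
    calc 1 / (queryCount ρ i * (ρ / 2 / t * (1 / t ^ 2) / 8) ^ 2)
        ≤ 1 / (2048 * t ^ 7 / ρ ^ 3 * (ρ / 2 / t * (1 / t ^ 2) / 8) ^ 2) := by gcongr
      _ = _ := by field_simp; norm_num
  have h2 : 1 / (2 : ℝ) ^ coinCount ρ i ≤ ρ / 8 / t := by
    calc 1 / (2 : ℝ) ^ coinCount ρ i ≤ 1 / (8 * t / ρ) := by gcongr
      _ = _ := by field_simp
  have h3 : 2 * (ρ / 2 / t * (1 / t ^ 2) / 8) / (1 / t ^ 2) = ρ / 8 / t := by field_simp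
  have h4 : ρ / 2 / t = ρ / 8 / t + (ρ / 8 / t + (ρ / 8 / t + ρ / 8 / t)) := by ring
  rw [h3]
  linarith

lemma optEstimator_isReplicable {d k : ℕ} {N : Seminorm ℝ (Fin d → ℝ)} {p β ε ρ δ : ℝ}
    (hd : 1 ≤ d) (hk : 1 ≤ k) (hp : 1 ≤ p) (hβ : 1 ≤ β) (hρ : 0 < ρ) (hδ : 0 < δ)
    (hδ' : δ < 1 / 3) {A : (n : ℕ) → (Fin n → diamBall N) → ℝ} (hA : IsValueOracle N k p β A) :
    (optEstimator d k p β ε ρ δ).IsReplicable A ρ := by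
  intro P _
  set m := queryCount ρ with hm
  set n := batchSize d k p δ with hn
  have hmpos : ∀ i, 0 < m i := queryCount_pos hρ
  set E : ℕ → ℝ := fun i => ∫ y, A (n i) y ∂(Measure.infinitePi fun _ : Fin (n i) => P)
  set τ : ℕ → ℝ := fun i => ρ / 2 / 2 ^ i * gridWidth i / 8 with hτ
  have hτpos : ∀ i, 0 < τ i := fun i => by have := gridWidth_pos i; positivity
  set B₁ : ℕ → Set (ℕ → diamBall N) := fun i => {x | τ i ≤ |oracleMean m n A i x - E i|}
  set B₂ : ℕ → Set (ℕ → Bool) := fun i => {r | ∃ y y', |y - E i| ≤ τ i ∧ |y' - E i| ≤ τ i ∧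
        randomRound (gridWidth i) (coinCount ρ i) (r, y) ≠
          randomRound (gridWidth i) (coinCount ρ i) (r, y')}
  have hB₁ : ∀ i, iidStream P (B₁ i) ≤ ENNReal.ofReal (1 / (m i * τ i ^ 2)) := fun i =>
    measure_blockMean_le P (hA.measurable (n i))
      (hA.mem_Icc hk hp hβ (batchSize_pos hd hk hp hδ hδ' i)) _ (hmpos i) (hτpos i)
  have hB₂ : ∀ i, coins (B₂ i) ≤
      ENNReal.ofReal (2 * τ i / gridWidth i + 1 / 2 ^ coinCount ρ i) := fun i =>
    coins_randomRound_ne_le (gridWidth_pos i) (hτpos i).le _ _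
  set B : ℕ → Set (((ℕ → diamBall N) × (ℕ → diamBall N)) × (ℕ → Bool)) := fun i =>
    {w | w.1 ∈ {v : (ℕ → diamBall N) × (ℕ → diamBall N) | v.1 ∈ B₁ i}} ∪
      ({w | w.1 ∈ {v : (ℕ → diamBall N) × (ℕ → diamBall N) | v.2 ∈ B₁ i}} ∪ {w | w.2 ∈ B₂ i})
    with hB
  have hBi : ∀ i, (((iidStream P).prod (iidStream P)).prod coins) (B i) ≤
      ENNReal.ofReal (ρ / 2 / 2 ^ i) := fun i => by
    have hg := gridWidth_pos i
    have ht := hτpos i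
    refine le_trans ?_ (ENNReal.ofReal_le_ofReal (stage_failure_le hρ i))
    rw [ENNReal.ofReal_add (by positivity) (by positivity),
      ENNReal.ofReal_add (by positivity) (by positivity)]
    refine (measure_union_le _ _).trans (add_le_add ?_ ((measure_union_le _ _).trans
      (add_le_add ?_ ?_)))
    · exact (measure_prod_fst_le _ _ _).trans ((measure_prod_fst_le _ _ _).trans (hB₁ i))
    · exact (measure_prod_fst_le _ _ _).trans ((measure_prod_snd_le _ _ _).trans (hB₁ i))
    · exact (measure_prod_snd_le _ _ _).trans (hB₂ i)
  refine (measure_mono ?_).trans (measure_iUnion_le_ofReal_of_geometric hρ.le hBi)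
  intro w hw
  by_contra hcon
  refine hw fun Λ => ?_
  simp only [Set.mem_iUnion, not_exists, hB, Set.mem_union, Set.mem_ofPred_eq, not_or] at hcon
  -- Outside the bad events the estimates of all stages coincide, including stages never reached.
  -- The two runs thus have the same outputs, or both run forever.
  have heq : ∀ i, randomRound (gridWidth i) (coinCount ρ i) (w.2, oracleMean m n A i w.1.1) =
      randomRound (gridWidth i) (coinCount ρ i) (w.2, oracleMean m n A i w.1.2) := fun i => by
    obtain ⟨h1, h2, h3⟩ := hcon i
    by_contra hne
    exact h3 ⟨_, _, (not_le.1 h1).le, (not_le.1 h2).le, hne⟩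
  simp only [optEstimator, stageAlgorithm_outputs_iff hmpos, ← hm, ← hn, heq]

end Replicable

/-! ### Accuracy -/

section Accuracy

/-- The union bound runs over all batches of a stage and all members of the net. With `t = 2^i` and
`ℓ = log(p/δ)`, the factor `4tm/δ` for `m` batches costs `exp(18tℓ)` and the net costs
`exp(6d²ktℓ)`. The batch size makes the Hoeffding factor at most `exp(-28d²ktℓ)`, and `18 + 6 ≤ 28`
since `d, k ≥ 1`. -/
lemma card_net_mul_exp_le {d k : ℕ} {p ρ δ : ℝ} (hd : 1 ≤ d) (hk : 1 ≤ k) (hp : 1 ≤ p)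
    (hρ : ρ ∈ Set.Ioo (0 : ℝ) 1) (hδ : δ ∈ Set.Ioo (0 : ℝ) (ρ / 3)) (i : ℕ) :
    queryCount ρ i * (((⌈4 * p * d * (2 ^ i) ^ 2⌉₊ : ℝ) + 1) ^ (d * k) *
      (2 * Real.exp (-(batchSize d k p δ i * gridWidth i ^ 2 / 2)))) ≤ δ / 2 / 2 ^ i := by
  obtain ⟨hρ0, hρ1⟩ := hρ
  obtain ⟨hδ0, hδ1⟩ := hδ
  have hL1 := one_le_log_div hp hδ0 (by linarith)
  have hn : 56 * (d : ℝ) ^ 2 * k * (2 ^ i) ^ 5 * Real.log (p / δ) ≤ batchSize d k p δ i :=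
    Nat.le_ceil _
  have ht : (1 : ℝ) ≤ 2 ^ i := one_le_two_pow_real i
  have hm : (queryCount ρ i : ℝ) ≤ 2048 * (2 ^ i) ^ 7 / ρ ^ 3 + 1 :=
    (Nat.ceil_lt_add_one (by positivity)).le
  have hLc : (⌈4 * p * d * (2 ^ i) ^ 2⌉₊ : ℝ) ≤ 4 * p * d * (2 ^ i) ^ 2 + 1 :=
    (Nat.ceil_lt_add_one (by positivity)).le
  have hd' : (1 : ℝ) ≤ d := by exact_mod_cast hd
  have hk' : (1 : ℝ) ≤ k := by exact_mod_cast hk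
  rw [gridWidth]
  generalize (2 : ℝ) ^ i = t at *
  set LL := Real.log (p / δ) with hLL
  have ht0 : 0 < t := by linarith
  have hLLsplit : LL = Real.log p + Real.log (1 / δ) := by
    rw [hLL, ← Real.log_mul (by positivity) (by positivity)]; congr 1; ring
  have hlogp : 0 ≤ Real.log p := Real.log_nonneg hp
  have hlogδ : 0 ≤ Real.log (1 / δ) := Real.log_nonneg (by rw [le_div_iff₀ hδ0]; linarith)
  have hlogt : Real.log t ≤ t - 1 := Real.log_le_sub_one_of_pos ht0
  have hlogd : Real.log d ≤ d - 1 := Real.log_le_sub_one_of_pos (by linarith)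
  have hdt : 1 ≤ (d : ℝ) * t := by nlinarith
  have hdtd : (d : ℝ) ≤ d * t := by nlinarith
  have hdtt : t ≤ d * t := by nlinarith
  have hdtL : (d : ℝ) * t ≤ d * t * LL := by nlinarith
  have hLdt : LL ≤ d * t * LL := by nlinarith
  -- the size of the net
  have h1 : (⌈4 * p * d * t ^ 2⌉₊ : ℝ) + 1 ≤ Real.exp (6 * d * t * LL) := by
    have hpd : 1 ≤ p * d * t ^ 2 := by
      have := one_le_mul_of_one_le_of_one_le hp hd'
      exact one_le_mul_of_one_le_of_one_le this (one_le_pow₀ ht)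
    have h2 : (⌈4 * p * d * t ^ 2⌉₊ : ℝ) + 1 ≤ 6 * p * d * t ^ 2 := by linarith
    refine h2.trans ?_
    rw [← Real.log_le_iff_le_exp (by positivity), Real.log_mul (by positivity) (by positivity),
      Real.log_mul (by positivity) (by positivity), Real.log_mul (by positivity) (by positivity),
      Real.log_pow]
    have h6 : Real.log 6 ≤ 6 - 1 := Real.log_le_sub_one_of_pos (by norm_num)
    push_cast
    linarith
  -- the number of events
  have h2 : 4 * t * queryCount ρ i / δ ≤ Real.exp (18 * t * LL) := by
    have hδρ : δ ≤ ρ := by linarith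
    have e1 : 1 ≤ t ^ 7 / δ ^ 3 := by
      rw [le_div_iff₀ (by positivity)]
      have h3 : δ ^ 3 ≤ 1 := pow_le_one₀ hδ0.le (by linarith)
      have h4 : 1 ≤ t ^ 7 := one_le_pow₀ ht
      linarith
    have e2 : (queryCount ρ i : ℝ) ≤ 2049 * (t ^ 7 / δ ^ 3) := by
      have : t ^ 7 / ρ ^ 3 ≤ t ^ 7 / δ ^ 3 := by gcongr
      rw [mul_div_assoc] at hm
      linarith
    have e3 : 4 * t * queryCount ρ i / δ ≤ 2 ^ 14 * t ^ 8 * (1 / δ) ^ 4 := by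
      calc 4 * t * queryCount ρ i / δ ≤ 4 * t * (2049 * (t ^ 7 / δ ^ 3)) / δ := by gcongr
        _ = 8196 * t ^ 8 * (1 / δ) ^ 4 := by field_simp; norm_num
        _ ≤ _ := by gcongr; norm_num
    refine e3.trans ?_
    rw [← Real.log_le_iff_le_exp (by positivity), Real.log_mul (by positivity) (by positivity),
      Real.log_mul (by positivity) (by positivity), Real.log_pow, Real.log_pow, Real.log_pow]
    have h6 : Real.log 2 ≤ 2 - 1 := Real.log_le_sub_one_of_pos (by norm_num)
    have h7 : t ≤ t * LL := by nlinarith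
    have h8 : LL ≤ t * LL := by nlinarith
    push_cast
    linarith
  have h3 : 28 * d ^ 2 * k * t * LL ≤ batchSize d k p δ i * (1 / t ^ 2) ^ 2 / 2 := by
    calc 28 * d ^ 2 * k * t * LL = 56 * d ^ 2 * k * t ^ 5 * LL * (1 / t ^ 2) ^ 2 / 2 := by
          field_simp; norm_num
      _ ≤ _ := by gcongr
  have h4 : ((⌈4 * p * d * t ^ 2⌉₊ : ℝ) + 1) ^ (d * k) ≤ Real.exp (6 * d ^ 2 * k * t * LL) := by
    refine (pow_le_pow_left₀ (by positivity) h1 _).trans (le_of_eq ?_)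
    rw [← Real.exp_nat_mul]
    congr 1
    push_cast
    ring
  have h5 : 18 * t * LL ≤ 22 * d ^ 2 * k * t * LL := by
    have : 1 ≤ (d : ℝ) ^ 2 * k := one_le_mul_of_one_le_of_one_le (one_le_pow₀ hd') hk'
    have htL : 0 ≤ t * LL := by positivity
    have := mul_le_mul_of_nonneg_right this htL
    linarith
  have h6 : Real.exp (-(batchSize d k p δ i * (1 / t ^ 2) ^ 2 / 2)) ≤
      Real.exp (-(28 * d ^ 2 * k * t * LL)) := Real.exp_le_exp.2 (neg_le_neg h3)
  have h7 : Real.exp (18 * t * LL) * Real.exp (6 * d ^ 2 * k * t * LL) *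
      Real.exp (-(28 * d ^ 2 * k * t * LL)) ≤ 1 := by
    rw [← Real.exp_add, ← Real.exp_add, Real.exp_le_one_iff]
    linarith
  have hQ : 0 ≤ ((⌈4 * p * d * t ^ 2⌉₊ : ℝ) + 1) ^ (d * k) := by positivity
  have hW := Real.exp_pos (-(batchSize d k p δ i * (1 / t ^ 2) ^ 2 / 2))
  generalize ((⌈4 * p * d * t ^ 2⌉₊ : ℝ) + 1) ^ (d * k) = Q at *
  generalize Real.exp (-(batchSize d k p δ i * (1 / t ^ 2) ^ 2 / 2)) = W at *
  calc queryCount ρ i * (Q * (2 * W))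
      = (4 * t * queryCount ρ i / δ) * Q * W * (δ / 2 / t) := by field_simp; norm_num
    _ ≤ 1 * (δ / 2 / t) := by
        refine mul_le_mul_of_nonneg_right (le_trans ?_ h7) (by positivity)
        exact mul_le_mul (mul_le_mul h2 h4 hQ (Real.exp_pos _).le) h6 hW.le (by positivity)
    _ = _ := one_mul _

/-! ### Accurate stages and the range of their estimates -/

variable {d k : ℕ} {N : Seminorm ℝ (Fin d → ℝ)} {p β ε ρ δ : ℝ}

/-- All queries of the `i`-th stage are on batches with accurate optimal sample cost. -/
def IsAccurateStage (N : Seminorm ℝ (Fin d → ℝ)) (k : ℕ) (p : ℝ) (P : Measure (diamBall N))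
    (m n : ℕ → ℕ) (i : ℕ) (x : ℕ → diamBall N) : Prop :=
  ∀ j < m i, |sampleOPT N k p (fun l : Fin (n i) => x (stageSamples m n i + j * n i + l)) -
    OPT N k p P| ≤ gridWidth i

lemma measure_not_isAccurateStage_le (hd : 1 ≤ d) (hk : 1 ≤ k) (hN : IsClusteringNorm N)
    (hp : 1 ≤ p) (hρ : ρ ∈ Set.Ioo (0 : ℝ) 1) (hδ : δ ∈ Set.Ioo (0 : ℝ) (ρ / 3))
    (P : Measure (diamBall N)) [IsProbabilityMeasure P] (i : ℕ) :
    iidStream P {x | ¬ IsAccurateStage N k p P (queryCount ρ) (batchSize d k p δ) i x} ≤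
      ENNReal.ofReal (δ / 2 / 2 ^ i) := by
  have hd' : (0 : ℝ) < d := by exact_mod_cast hd
  set L := ⌈4 * p * d * (2 ^ i) ^ 2⌉₊ with hL
  have hL1 : 4 * p * d * (2 ^ i) ^ 2 ≤ (L : ℝ) := Nat.le_ceil _
  have hL0 : 0 < L := Nat.ceil_pos.2 (by positivity)
  have hL0' : (0 : ℝ) < L := by exact_mod_cast hL0
  have hLα : p * (d / L) ≤ gridWidth i / 4 := by
    rw [gridWidth, div_div, ← mul_div_assoc, div_le_div_iff₀ hL0' (by positivity)]
    linarith
  have hδ3 : δ < 1 / 3 := by linarith [hδ.2, hρ.2]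
  have h1 := fun j => measure_sampleOPT_deviation_le hN hk hp P (gridWidth_pos i) hL0 hLα
    (stageSamples (queryCount ρ) (batchSize d k p δ) i + j * batchSize d k p δ i)
    (batchSize_pos hd hk hp hδ.1 hδ3 i)
  refine le_trans ?_ (ENNReal.ofReal_le_ofReal (card_net_mul_exp_le hd hk hp hρ hδ i))
  refine (measure_mono ?_).trans ((measure_biUnion_finset_le
    (Finset.range (queryCount ρ i)) _).trans ((Finset.sum_le_sum fun j _ => h1 j).trans ?_))
  · intro x hx
    simp only [IsAccurateStage, Set.mem_ofPred_eq, not_forall] at hx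
    obtain ⟨j, hj, h⟩ := hx
    exact Set.mem_biUnion (Finset.mem_coe.2 (Finset.mem_range.2 hj)) h
  · rw [Finset.sum_const, Finset.card_range, nsmul_eq_mul, ENNReal.ofReal_mul (Nat.cast_nonneg _),
      ENNReal.ofReal_natCast]

lemma IsAccurateStage.oracleMean_mem_Icc {P : Measure (diamBall N)} {m n : ℕ → ℕ} {i : ℕ}
    {x : ℕ → diamBall N} (h : IsAccurateStage N k p P m n i x) (hβ : 1 ≤ β)
    {A : (n : ℕ) → (Fin n → diamBall N) → ℝ} (hA : IsValueOracle N k p β A) (hm : 0 < m i)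
    (hn : 1 ≤ n i) : oracleMean m n A i x ∈
      Set.Icc ((OPT N k p P - gridWidth i) / β) (OPT N k p P + gridWidth i) := by
  have hm' : (0 : ℝ) < m i := by exact_mod_cast hm
  have key : ∀ j ∈ Finset.range (m i),
      A (n i) (fun l => x (stageSamples m n i + j * n i + l)) ∈
      Set.Icc ((OPT N k p P - gridWidth i) / β) (OPT N k p P + gridWidth i) := fun j hj => by
    have h1 := abs_le.1 (h j (Finset.mem_range.1 hj))
    have h2 := hA.approx (n i) hn fun l => x (stageSamples m n i + j * n i + l)
    refine ⟨le_trans ?_ h2.1, h2.2.trans (by linarith)⟩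
    rw [div_eq_inv_mul, ← one_div]
    exact mul_le_mul_of_nonneg_left (by linarith) (by positivity)
  rw [oracleMean, Set.mem_Icc, le_div_iff₀ hm', div_le_iff₀ hm']
  have h1 := Finset.card_nsmul_le_sum _ _ _ fun j hj => (key j hj).1
  have h2 := Finset.sum_le_card_nsmul _ _ _ fun j hj => (key j hj).2
  rw [Finset.card_range, nsmul_eq_mul] at h1 h2
  constructor <;> linarith

/-- The lower end loses `α/β ≤ α` through the oracle and another `α` through rounding down; the
upper end is not raised by rounding. -/
lemma IsAccurateStage.randomRound_mem_Icc {P : Measure (diamBall N)} {m n : ℕ → ℕ} {i : ℕ}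
    {x : ℕ → diamBall N} (h : IsAccurateStage N k p P m n i x) (hβ : 1 ≤ β)
    {A : (n : ℕ) → (Fin n → diamBall N) → ℝ} (hA : IsValueOracle N k p β A) (hm : 0 < m i)
    (hn : 1 ≤ n i) (q : ℕ) (r : ℕ → Bool) :
    randomRound (gridWidth i) q (r, oracleMean m n A i x) ∈
      Set.Icc (OPT N k p P / β - 2 * gridWidth i) (OPT N k p P + gridWidth i) := by
  have hg := gridWidth_pos i
  have h1 := h.oracleMean_mem_Icc hβ hA hm hn
  have h2 := randomRound_mem_Ioc hg q r (oracleMean m n A i x)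
  have h3 : gridWidth i / β ≤ gridWidth i := div_le_self hg.le hβ
  have h4 := h1.1
  rw [sub_div] at h4
  exact ⟨by linarith [h2.1], h2.2.trans h1.2⟩

/-! ### The stopping rule and relative error -/

lemma threshold_le {O α : ℝ} (hβ : 1 ≤ β) (hε : ε ∈ Set.Ioo (0 : ℝ) 1) (hα : 0 < α)
    (h : 7 * β ^ 2 * α ≤ O * ε) : (4 * β / ε + 1) * α ≤ O / β - 2 * α := by
  have hε0 := hε.1
  have h1 : (3 : ℝ) ≤ 3 * β / ε := by
    rw [le_div_iff₀ hε0]; nlinarith [hε.2]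
  have h2 : 7 * β / ε * α ≤ O / β := by
    rw [div_mul_eq_mul_div, div_le_div_iff₀ hε0 (by linarith)]
    linarith
  -- Here `7 = 4 + 3`: the part `3β/ε ≥ 3` pays for the summand `1` of the threshold and for the
  -- error `2α`.
  have h3 : 7 * β / ε = 4 * β / ε + 3 * β / ε := by ring
  rw [h3] at h2
  nlinarith

lemma mem_Icc_of_threshold_le {O α Λ : ℝ} (hO : 0 < O) (hβ : 1 ≤ β)
    (hε : ε ∈ Set.Ioo (0 : ℝ) 1) (h : Λ ∈ Set.Icc (O / β - 2 * α) (O + α))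
    (hthr : (4 * β / ε + 1) * α ≤ Λ) :
    Λ ∈ Set.Icc (1 / (β * (1 + ε)) * O) ((1 + ε) * O) := by
  obtain ⟨hε0, hε1⟩ := hε
  have hβ0 : 0 < β := by linarith
  -- The summand `1` in the threshold cancels the upper error `α` of the estimate.
  have h1 : 4 * β / ε * α ≤ O := by nlinarith [h.2]
  have h2 : 4 * β * α ≤ O * ε := by
    rwa [div_mul_eq_mul_div, div_le_iff₀ hε0] at h1
  constructor
  · refine le_trans ?_ h.1
    have h3 : 2 * α ≤ O * ε / (2 * β) := by rw [le_div_iff₀ (by positivity)]; linarith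
    -- This is `1/(1+ε) ≤ 1 - ε/2`, equivalent to `ε(1 - ε) ≥ 0`.
    have h4 : 1 / (β * (1 + ε)) * O ≤ O / β - O * ε / (2 * β) := by
      have e : O / β - O * ε / (2 * β) = (O * (2 - ε)) / (2 * β) := by field_simp
      rw [e, one_div_mul_eq_div, div_le_div_iff₀ (by positivity) (by positivity)]
      have : 0 ≤ O * β * (ε * (1 - ε)) := by
        have : 0 ≤ 1 - ε := by linarith
        positivity
      nlinarith
    linarith
  · have h5 : α ≤ O * ε := by
      rcases le_or_gt α 0 with h6 | h6
      · exact h6.trans (by positivity)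
      · nlinarith
    linarith [h.2]

/-! ### Sample complexity -/

lemma stageSamples_le (hd : 1 ≤ d) (hk : 1 ≤ k) (hp : 1 ≤ p) (hρ : ρ ∈ Set.Ioo (0 : ℝ) 1)
    (hδ : δ ∈ Set.Ioo (0 : ℝ) (ρ / 3)) (i : ℕ) :
    (stageSamples (queryCount ρ) (batchSize d k p δ) (i + 1) : ℝ) ≤
      2049 * 57 * 2 * (d ^ 2 * k * Real.log (p / δ) / ρ ^ 3) * ((2 ^ i) ^ 2) ^ 6 := by
  obtain ⟨hρ0, hρ1⟩ := hρ
  have hL1 := one_le_log_div hp hδ.1 (by linarith [hδ.2])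
  have hd' : (1 : ℝ) ≤ d := by exact_mod_cast hd
  have hk' : (1 : ℝ) ≤ k := by exact_mod_cast hk
  set LL := Real.log (p / δ)
  have hj : ∀ j, ((queryCount ρ j * batchSize d k p δ j : ℕ) : ℝ) ≤
      2049 * 57 * (d ^ 2 * k * LL / ρ ^ 3) * ((2 ^ j) ^ 2) ^ 6 := fun j => by
    have ht := one_le_two_pow_real j
    have hm : (queryCount ρ j : ℝ) ≤ 2048 * (2 ^ j) ^ 7 / ρ ^ 3 + 1 :=
      (Nat.ceil_lt_add_one (by positivity)).le
    have hn : (batchSize d k p δ j : ℝ) ≤ 56 * (d : ℝ) ^ 2 * k * (2 ^ j) ^ 5 * LL + 1 :=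
      (Nat.ceil_lt_add_one (by positivity)).le
    push_cast
    generalize (2 : ℝ) ^ j = t at *
    have h1 : 1 ≤ t ^ 7 / ρ ^ 3 := by
      rw [le_div_iff₀ (by positivity)]
      have h3 : ρ ^ 3 ≤ 1 := pow_le_one₀ hρ0.le hρ1.le
      have h4 : 1 ≤ t ^ 7 := one_le_pow₀ ht
      linarith
    have h2 : 1 ≤ (d : ℝ) ^ 2 * k * t ^ 5 * LL :=
      one_le_mul_of_one_le_of_one_le (one_le_mul_of_one_le_of_one_le
        (one_le_mul_of_one_le_of_one_le (one_le_pow₀ hd') hk') (one_le_pow₀ ht)) hL1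
    calc (queryCount ρ j : ℝ) * batchSize d k p δ j
        ≤ (2049 * (t ^ 7 / ρ ^ 3)) * (57 * ((d : ℝ) ^ 2 * k * t ^ 5 * LL)) := by
          refine mul_le_mul ?_ (by linarith) (by positivity) (by positivity)
          rw [mul_div_assoc] at hm
          linarith
      _ = _ := by field_simp
  -- The terms grow by the factor `4096` from stage to stage, so twice the last one bounds the sum.
  have hsum : ∀ i : ℕ, ∑ j ∈ Finset.range (i + 1), (((2 : ℝ) ^ j) ^ 2) ^ 6 ≤
      2 * ((2 ^ i) ^ 2) ^ 6 := fun i => by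
    induction i with
    | zero => norm_num
    | succ i ih =>
      rw [Finset.sum_range_succ, pow_succ (2 : ℝ) i]
      have : (0 : ℝ) ≤ ((2 ^ i) ^ 2) ^ 6 := by positivity
      nlinarith
  rw [stageSamples, Nat.cast_sum]
  refine (Finset.sum_le_sum fun j _ => hj j).trans ?_
  rw [← Finset.mul_sum]
  calc _ ≤ 2049 * 57 * (d ^ 2 * k * LL / ρ ^ 3) * (2 * ((2 ^ i) ^ 2) ^ 6) := by
        gcongr
        exact hsum i
    _ = _ := by ring

/-- The argument yields the exponents `6` for `ε` and `O`, `3` for `ρ` and `1` for `k`; these are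
weakened to the stated ones using `ε, O, ρ ≤ 1 ≤ k`. -/
lemma sample_bound {O : ℝ} (hO : O ∈ Set.Ioc (0 : ℝ) 1) (hd : 1 ≤ d) (hk : 1 ≤ k) (hp : 1 ≤ p)
    (hβ : 1 ≤ β) (hε : ε ∈ Set.Ioo (0 : ℝ) 1) (hρ : ρ ∈ Set.Ioo (0 : ℝ) 1)
    (hδ : δ ∈ Set.Ioo (0 : ℝ) (ρ / 3)) {i : ℕ} (hi : (2 ^ i) ^ 2 * (O * ε) ≤ 28 * β ^ 2) :
    (stageSamples (queryCount ρ) (batchSize d k p δ) (i + 1) : ℝ) ≤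
      softO (2049 * 57 * 2 * 28 ^ 6) 0 ((k : ℝ) ^ 2 * (d : ℝ) ^ 2 * β ^ 12 /
        (ε ^ 12 * ρ ^ 6 * O ^ 12) * Real.log (p / δ)) := by
  refine (stageSamples_le hd hk hp hρ hδ i).trans ?_
  obtain ⟨hε0, hε1⟩ := hε
  obtain ⟨hO0, hO1⟩ := hO
  have hL1 := one_le_log_div hp hδ.1 (by linarith [hδ.2, hρ.2])
  obtain ⟨hρ0, hρ1⟩ := hρ
  have hd' : (1 : ℝ) ≤ d := by exact_mod_cast hd
  have hk' : (1 : ℝ) ≤ k := by exact_mod_cast hk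
  rw [← le_div_iff₀ (by positivity)] at hi
  have h1 : (d : ℝ) ^ 2 * k ≤ k ^ 2 * d ^ 2 := by
    have : (k : ℝ) ≤ k ^ 2 := by nlinarith
    nlinarith [sq_nonneg (d : ℝ)]
  have h2 : ρ ^ 6 ≤ ρ ^ 3 := pow_le_pow_of_le_one hρ0.le hρ1.le (by norm_num)
  have h3 : (O * ε) ^ 12 ≤ (O * ε) ^ 6 :=
    pow_le_pow_of_le_one (by positivity) (by nlinarith) (by norm_num)
  calc 2049 * 57 * 2 * (d ^ 2 * k * Real.log (p / δ) / ρ ^ 3) * ((2 ^ i) ^ 2) ^ 6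
      ≤ 2049 * 57 * 2 * (k ^ 2 * d ^ 2 * Real.log (p / δ) / ρ ^ 6) *
          (28 * β ^ 2 / (O * ε)) ^ 6 := by gcongr
    _ = 2049 * 57 * 2 * (k ^ 2 * d ^ 2 * Real.log (p / δ) / ρ ^ 6) *
          (28 ^ 6 * β ^ 12 / (O * ε) ^ 6) := by rw [div_pow]; ring
    _ ≤ 2049 * 57 * 2 * (k ^ 2 * d ^ 2 * Real.log (p / δ) / ρ ^ 6) *
          (28 ^ 6 * β ^ 12 / (O * ε) ^ 12) := by gcongr
    _ = _ := by rw [softO, pow_zero, mul_one]; field_simp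

/-- In an accurate stage with high accuracy, the estimate reaches the threshold. -/
lemma threshold_le_randomRound_of_isAccurateStage (hd : 1 ≤ d) (hk : 1 ≤ k) (hp : 1 ≤ p) (hβ : 1 ≤ β)
    (hε : ε ∈ Set.Ioo (0 : ℝ) 1) (hρ : ρ ∈ Set.Ioo (0 : ℝ) 1)
    (hδ : δ ∈ Set.Ioo (0 : ℝ) (ρ / 3)) {A : (n : ℕ) → (Fin n → diamBall N) → ℝ}
    (hA : IsValueOracle N k p β A) {P : Measure (diamBall N)} {x : ℕ → diamBall N}
    (r : ℕ → Bool) {i : ℕ}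
    (hx : IsAccurateStage N k p P (queryCount ρ) (batchSize d k p δ) i x)
    (hi : 7 * β ^ 2 * gridWidth i ≤ OPT N k p P * ε) :
    (4 * β / ε + 1) * gridWidth i ≤ randomRound (gridWidth i) (coinCount ρ i)
      (r, oracleMean (queryCount ρ) (batchSize d k p δ) A i x) :=
  (threshold_le hβ hε (gridWidth_pos i) hi).trans
    (hx.randomRound_mem_Icc hβ hA (queryCount_pos hρ.1 i)
      (batchSize_pos hd hk hp hδ.1 (by linarith [hδ.2, hρ.2]) i) _ r).1

/-! ### Termination and correctness of the estimator -/

lemma eventually_gridWidth_le {O : ℝ} (hO : 0 < O) (β : ℝ) (hε : 0 < ε) :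
    ∀ᶠ i in Filter.atTop, 7 * β ^ 2 * gridWidth i ≤ O * ε := by
  have h : Filter.Tendsto (fun i => 7 * β ^ 2 * gridWidth i) Filter.atTop (nhds (7 * β ^ 2 * 0)) := by
    refine Filter.Tendsto.const_mul _ ?_
    have h1 := tendsto_pow_atTop_nhds_zero_of_lt_one (r := (1 / 4 : ℝ)) (by norm_num) (by norm_num)
    refine h1.congr fun i => ?_
    rw [gridWidth, ← pow_mul, mul_comm, pow_mul, one_div_pow]
    norm_num
  rw [mul_zero] at h
  exact (h.eventually (gt_mem_nhds (mul_pos hO hε))).mono fun _ h => h.le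

lemma exists_least_stage (u thr : ℕ → ℝ) (h : ∃ i, thr i ≤ u i) :
    ∃ i, (∀ j < i, u j < thr j) ∧ thr i ≤ u i := by
  classical
  exact ⟨Nat.find h, fun j hj => not_le.1 (Nat.find_min h hj), Nat.find_spec h⟩

/-- A run that never halts must be inaccurate in each sufficiently late stage `i`. This has
probability at most `δ / 2^(i+1)`, which tends to zero. -/
lemma optEstimator_ae_halts (hd : 1 ≤ d) (hk : 1 ≤ k) (hN : IsClusteringNorm N) (hp : 1 ≤ p)
    (hβ : 1 ≤ β) (hε : ε ∈ Set.Ioo (0 : ℝ) 1) (hρ : ρ ∈ Set.Ioo (0 : ℝ) 1)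
    (hδ : δ ∈ Set.Ioo (0 : ℝ) (ρ / 3)) {A : (n : ℕ) → (Fin n → diamBall N) → ℝ}
    (hA : IsValueOracle N k p β A) (P : Measure (diamBall N)) [IsProbabilityMeasure P]
    (hOPT : 0 < OPT N k p P) :
    ∀ᵐ w ∂((iidStream P).prod coins),
      ∃ Λ m, (optEstimator d k p β ε ρ δ).Outputs A w.1 w.2 Λ m := by
  rw [ae_iff]
  have h1 : ∀ᶠ i in Filter.atTop, ((iidStream P).prod coins)
      {w | ¬ ∃ Λ m, (optEstimator d k p β ε ρ δ).Outputs A w.1 w.2 Λ m} ≤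
      ENNReal.ofReal (δ / 2 / 2 ^ i) := by
    filter_upwards [eventually_gridWidth_le hOPT β hε.1] with i hi
    refine le_trans ((measure_mono ?_).trans (measure_prod_fst_le _ _ _))
      (measure_not_isAccurateStage_le hd hk hN hp hρ hδ P i)
    intro w hw hacc
    obtain ⟨i₀, h1, h2⟩ := exists_least_stage
      (fun i => randomRound (gridWidth i) (coinCount ρ i)
        (w.2, oracleMean (queryCount ρ) (batchSize d k p δ) A i w.1))
      (fun i => (4 * β / ε + 1) * gridWidth i)
      ⟨i, threshold_le_randomRound_of_isAccurateStage hd hk hp hβ hε hρ hδ hA w.2 hacc hi⟩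
    exact hw ⟨_, _, (stageAlgorithm_outputs_iff (queryCount_pos hρ.1) A w.1 w.2 _ _).2
      ⟨i₀, h1, h2, rfl, rfl⟩⟩
  have h2 : Filter.Tendsto (fun i : ℕ => ENNReal.ofReal (δ / 2 / 2 ^ i)) Filter.atTop (nhds 0) := by
    rw [← ENNReal.ofReal_zero]
    refine ENNReal.tendsto_ofReal ?_
    have h3 := (tendsto_pow_atTop_nhds_zero_of_lt_one (r := (1 / 2 : ℝ)) (by norm_num)
      (by norm_num)).const_mul (δ / 2)
    rw [mul_zero] at h3
    refine h3.congr fun i => ?_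
    rw [one_div_pow, mul_one_div]
  exact le_antisymm (ge_of_tendsto h2 h1) zero_le

lemma optEstimator_accurate (hd : 1 ≤ d) (hk : 1 ≤ k) (hN : IsClusteringNorm N) (hp : 1 ≤ p)
    (hβ : 1 ≤ β) (hε : ε ∈ Set.Ioo (0 : ℝ) 1) (hρ : ρ ∈ Set.Ioo (0 : ℝ) 1)
    (hδ : δ ∈ Set.Ioo (0 : ℝ) (ρ / 3)) {A : (n : ℕ) → (Fin n → diamBall N) → ℝ}
    (hA : IsValueOracle N k p β A) (P : Measure (diamBall N)) [IsProbabilityMeasure P]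
    (hOPT : 0 < OPT N k p P) :
    ((iidStream P).prod coins)
      {w | ¬ ∃ Λ m, (optEstimator d k p β ε ρ δ).Outputs A w.1 w.2 Λ m ∧
        Λ ∈ Set.Icc (1 / (β * (1 + ε)) * OPT N k p P) ((1 + ε) * OPT N k p P) ∧
        (m : ℝ) ≤ softO (2049 * 57 * 2 * 28 ^ 6) 0 ((k : ℝ) ^ 2 * (d : ℝ) ^ 2 * β ^ 12 /
          (ε ^ 12 * ρ ^ 6 * OPT N k p P ^ 12) * Real.log (p / δ))} ≤ ENNReal.ofReal δ := by
  have hδ3 : δ < 1 / 3 := by linarith [hδ.2, hρ.2]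
  have hO1 : OPT N k p P ≤ 1 := OPT_le_one hN hk hp P
  refine le_trans ((measure_mono ?_).trans (measure_prod_fst_le _ _
    (⋃ i, {x | ¬ IsAccurateStage N k p P (queryCount ρ) (batchSize d k p δ) i x})))
    (measure_iUnion_le_ofReal_of_geometric hδ.1.le
      (measure_not_isAccurateStage_le hd hk hN hp hρ hδ P))
  intro w hw
  by_contra hcon
  simp only [Set.mem_iUnion, not_exists, Set.mem_ofPred_eq, not_not] at hcon
  obtain ⟨I, hI⟩ := (eventually_gridWidth_le hOPT β hε.1).exists
  obtain ⟨i, h1, h2⟩ := exists_least_stage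
    (fun i => randomRound (gridWidth i) (coinCount ρ i)
      (w.2, oracleMean (queryCount ρ) (batchSize d k p δ) A i w.1))
    (fun i => (4 * β / ε + 1) * gridWidth i)
    ⟨I, threshold_le_randomRound_of_isAccurateStage hd hk hp hβ hε hρ hδ hA w.2 (hcon I) hI⟩
  refine hw ⟨_, _, (stageAlgorithm_outputs_iff (queryCount_pos hρ.1) A w.1 w.2 _ _).2
    ⟨i, h1, h2, rfl, rfl⟩, ?_, ?_⟩
  · exact mem_Icc_of_threshold_le hOPT hβ hε ((hcon i).randomRound_mem_Icc hβ hA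
      (queryCount_pos hρ.1 i) (batchSize_pos hd hk hp hδ.1 hδ3 i) _ w.2) h2
  · refine sample_bound ⟨hOPT, hO1⟩ hd hk hp hβ hε hρ hδ ?_
    have hOε : OPT N k p P * ε ≤ 1 := mul_le_one₀ hO1 hε.1.le hε.2.le
    -- Stopping at stage 0 gives the bound from `OPT · ε ≤ 1`. Otherwise the preceding stage did not
    -- stop, so its accuracy was too coarse; passing to the next stage turns `7` into `28 = 4 · 7`.
    rcases i with _ | i
    · norm_num
      nlinarith
    · have h3 : OPT N k p P * ε < 7 * β ^ 2 * gridWidth i := by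
        by_contra h4
        exact absurd (threshold_le_randomRound_of_isAccurateStage hd hk hp hβ hε hρ hδ hA w.2 (hcon i)
          (not_lt.1 h4)) (not_le.2 (h1 i i.lt_succ_self))
      have ht : (0 : ℝ) < (2 ^ i) ^ 2 := by positivity
      rw [gridWidth, mul_one_div, lt_div_iff₀ ht] at h3
      rw [pow_succ (2 : ℝ) i, mul_pow]
      linarith

end Accuracy

end ReplicableClustering

/-! ### Conclusion -/

theorem mainTheorem9 :
    ∃ (C : ℝ) (c : ℕ), 0 < C ∧
      ∀ (d k : ℕ) (N : Seminorm ℝ (Fin d → ℝ)) (p β ε ρ δ : ℝ),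
        1 ≤ d → 1 ≤ k → ReplicableClustering.IsClusteringNorm N → 1 ≤ p → 1 ≤ β →
        ε ∈ Set.Ioo (0 : ℝ) 1 → ρ ∈ Set.Ioo (0 : ℝ) 1 → δ ∈ Set.Ioo (0 : ℝ) (ρ / 3) →
        ∃ alg : ReplicableClustering.OracleAlgorithm,
          ∀ A : (n : ℕ) → (Fin n → ReplicableClustering.diamBall N) → ℝ,
            ReplicableClustering.IsValueOracle N k p β A →
            alg.IsReplicable A ρ ∧
            ∀ (P : Measure (ReplicableClustering.diamBall N)) [IsProbabilityMeasure P],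
              0 < ReplicableClustering.OPT N k p P →
              (∀ᵐ w ∂((ReplicableClustering.iidStream P).prod ReplicableClustering.coins),
                ∃ Λ m, alg.Outputs A w.1 w.2 Λ m) ∧
              ((ReplicableClustering.iidStream P).prod ReplicableClustering.coins)
                {w | ¬ ∃ Λ m, alg.Outputs A w.1 w.2 Λ m ∧
                  Λ ∈ Set.Icc (1 / (β * (1 + ε)) * ReplicableClustering.OPT N k p P)
                    ((1 + ε) * ReplicableClustering.OPT N k p P) ∧
                  (m : ℝ) ≤ ReplicableClustering.softO C c
                    ((k : ℝ) ^ 2 * (d : ℝ) ^ 2 * β ^ 12 /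
                      (ε ^ 12 * ρ ^ 6 * ReplicableClustering.OPT N k p P ^ 12) *
                      Real.log (p / δ))}
                ≤ ENNReal.ofReal δ := by
  -- `2049` and `57` absorb the roundings up of `2048` and `56`, `2` is the geometric sum and `28 ^
  -- 6` the stopping scale. No logarithmic factor is needed.
  refine ⟨2049 * 57 * 2 * 28 ^ 6, 0, by norm_num, ?_⟩
  intro d k N p β ε ρ δ hd hk hN hp hβ hε hρ hδ
  have hδ3 : δ < 1 / 3 := by linarith [hδ.2, hρ.2]
  refine ⟨ReplicableClustering.optEstimator d k p β ε ρ δ, fun A hA =>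
    ⟨ReplicableClustering.optEstimator_isReplicable hd hk hp hβ hρ.1 hδ.1 hδ3 hA,
      fun P _ hOPT => ⟨?_, ?_⟩⟩⟩
  · exact ReplicableClustering.optEstimator_ae_halts hd hk hN hp hβ hε hρ hδ hA P hOPT
  · exact ReplicableClustering.optEstimator_accurate hd hk hN hp hβ hε hρ hδ hA P hOPT
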